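/- Let $q$ be a prime power and $n\ge 0$. A Hessenberg function is a weakly increasing function $m:[n]\to[n]$ with $m(i)\ge i$ for all $i$. For a linear operator $T$ on $\mathbb F_q^n$ let $\mathscr H(m,T)$ be the set of complete flags $V_1\subseteq V_2\subseteq\cdots\subseteq V_n=\mathbb F_q^n$ of subspaces ($\dim V_i=i$) with $TV_i\subseteq V_{m(i)}$ for all $i\in[n]$, i.e. the set of $\mathbb F_q$-points of the Hessenberg variety of $m$ and $T$. For a partition $\lambda=(\lambda_1\ge\cdots\ge\lambda_\ell)$ of $n$ let $\mathrm{fl}_\lambda(T)$ be the number of sequences $0=W_0\subseteq W_1\subseteq\cdots\subseteq W_\ell$ of $T$-invariant subspaces of $\mathbb F_q^n$ with $\dim W_i/W_{i-1}=\lambda_i$ for $1\le i\le \ell$, and let $$F_T(x)=\sum_{\lambda\vdash n}\mathrm{fl}_\lambda(T)\,m_\lambda ,$$ where $m_\lambda$ is the monomial symmetric function in $x=(x_1,x_2,\ldots)$. Let $G(m)$ be the graph with vertex set $[n]$ and edges $\{i,j\}$ for $i<j\le m(i)$, and let $$X_{G(m)}(x;t)=\sum_{\kappa}t^{\mathrm{asc}(\kappa)}x_{\kappa(1)}\cdots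 x_{\kappa(n)}$$ be its chromatic quasisymmetric function, where $\kappa$ runs over all proper colorings of $G(m)$ by positive integers and $\mathrm{asc}(\kappa)$ is the number of edges $\{i,j\}$ with $i<j$ and $\kappa(i)<\kappa(j)$. Theorem. For every linear operator $T$ on $\mathbb F_q^n$ (whether or not its characteristic polynomial splits over $\mathbb F_q$) and every Hessenberg function $m:[n]\to[n]$, the series $X_{G(m)}(x;q)$ is a symmetric function and $$|\mathscr H(m,T)|=\langle F_T(x),\,\omega X_{G(m)}(x;q)\rangle ,$$ where $\langle\cdot,\cdot\rangle$ is the Hall scalar product on symmetric functions (for which the monomial symmetric functions $m_\lambda$ and the complete homogeneous symmetric functions $h_\lambda$ are dual bases) and $\omega$ is the standard involution of the ring of symmetric functions, taking the elementary symmetric function $e_k$ to $h_k$ for every $k$ (equivalently, the Schur function $s_\lambda$ to $s_{\lambda'}$). -/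

import Mathlib

/-! Symmetric functions in the variables `x 0, x 1, x 2, …`. -/

/-- The ring of symmetric functions over `R`: formal power series of bounded degree in the
variables `x i`, `i : ℕ`, that are fixed by every permutation of the variables. -/
noncomputable def SymmFun (R : Type*) [CommRing R] : Subalgebra R (MvPowerSeries ℕ R) where
  carrier := {f | (∃ N : ℕ, ∀ d : ℕ →₀ ℕ, N < d.degree → MvPowerSeries.coeff d f = 0) ∧
    ∀ σ : Equiv.Perm ℕ, MvPowerSeries.renameEquiv R σ f = f}
  mul_mem' := by
    classical
    rintro f g ⟨⟨N, hN⟩, hf⟩ ⟨⟨M, hM⟩, hg⟩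
    refine ⟨⟨N + M, fun d hd => ?_⟩, fun σ => by rw [map_mul, hf, hg]⟩
    rw [MvPowerSeries.coeff_mul]
    refine Finset.sum_eq_zero fun p hp => ?_
    rw [Finset.HasAntidiagonal.mem_antidiagonal] at hp
    have h : p.1.degree + p.2.degree = d.degree := by rw [← map_add, hp]
    rcases lt_or_ge N p.1.degree with h1 | h1
    · rw [hN _ h1, zero_mul]
    · rw [hM _ (by omega), mul_zero]
  add_mem' := by
    rintro f g ⟨⟨N, hN⟩, hf⟩ ⟨⟨M, hM⟩, hg⟩
    refine ⟨⟨N + M, fun d hd => ?_⟩, fun σ => by rw [map_add, hf, hg]⟩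
    rw [map_add, hN _ (by omega), hM _ (by omega), add_zero]
  algebraMap_mem' := by
    classical
    intro r
    refine ⟨⟨0, fun d hd => ?_⟩, fun σ => AlgEquiv.commutes _ _⟩
    rw [MvPowerSeries.algebraMap_apply, MvPowerSeries.coeff_C, if_neg]
    rintro rfl
    simp at hd

namespace SymmFun

variable {R : Type*} [CommRing R]

theorem coeff_renameEquiv (σ : Equiv.Perm ℕ) (f : MvPowerSeries ℕ R) (d : ℕ →₀ ℕ) :
    MvPowerSeries.coeff (d.mapDomain σ) (MvPowerSeries.renameEquiv R σ f) =
      MvPowerSeries.coeff d f := by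
  have h := MvPowerSeries.coeff_embDomain_rename (R := R) σ.toEmbedding f d
  rw [Finsupp.embDomain_eq_mapDomain] at h
  exact h

theorem coeff_mapDomain (f : SymmFun R) (σ : Equiv.Perm ℕ) (d : ℕ →₀ ℕ) :
    MvPowerSeries.coeff (d.mapDomain σ) (f : MvPowerSeries ℕ R) =
      MvPowerSeries.coeff d (f : MvPowerSeries ℕ R) := by
  conv_lhs => rw [← f.2.2 σ]
  exact coeff_renameEquiv σ _ d

theorem mem_of_coeff (f : MvPowerSeries ℕ R) (N : ℕ)
    (h : ∀ d : ℕ →₀ ℕ, N < d.degree → MvPowerSeries.coeff d f = 0)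
    (hσ : ∀ (σ : Equiv.Perm ℕ) (d : ℕ →₀ ℕ),
      MvPowerSeries.coeff (d.mapDomain σ) f = MvPowerSeries.coeff d f) : f ∈ SymmFun R := by
  refine ⟨⟨N, h⟩, fun σ => ?_⟩
  ext d
  have hd : d = (d.mapDomain σ.symm).mapDomain σ := by
    rw [← Finsupp.mapDomain_comp]
    simp [Finsupp.mapDomain_id]
  conv_lhs => rw [hd, coeff_renameEquiv]
  conv_rhs => rw [hd, hσ]

/-- The multiset of the nonzero exponents of a monomial. -/
noncomputable def exponents (d : ℕ →₀ ℕ) : Multiset ℕ := d.support.val.map d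

theorem exponents_mapDomain (σ : Equiv.Perm ℕ) (d : ℕ →₀ ℕ) :
    exponents (d.mapDomain σ) = exponents d := by
  have h : d.mapDomain σ = d.embDomain σ.toEmbedding := by
    rw [Finsupp.embDomain_eq_mapDomain]; rfl
  rw [h, exponents, exponents, Finsupp.support_embDomain, Finset.map_val, Multiset.map_map]
  exact Multiset.map_congr rfl fun i _ => Finsupp.embDomain_apply_self _ _ _

theorem sum_exponents (d : ℕ →₀ ℕ) : (exponents d).sum = d.degree := rfl

variable (R) in
/-- The complete homogeneous symmetric function `h n`: the sum of all monomials of degree `n`. -/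
noncomputable def h (n : ℕ) : SymmFun R :=
  ⟨fun d => if d.degree = n then 1 else 0, by
    apply mem_of_coeff _ n
    · intro d hd
      exact if_neg hd.ne'
    · intro σ d
      change (if (d.mapDomain σ).degree = n then (1 : R) else 0) = if d.degree = n then 1 else 0
      rw [Finsupp.degree_mapDomain]⟩

variable (R) in
/-- The elementary symmetric function `e n`: the sum of all squarefree monomials of
degree `n`. -/
noncomputable def e (n : ℕ) : SymmFun R :=
  open Classical in
  ⟨fun d => if d.degree = n ∧ ∀ i, d i ≤ 1 then 1 else 0, by
    classical
    apply mem_of_coeff _ n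
    · intro d hd
      exact if_neg fun h => hd.ne' h.1
    · intro σ d
      change (if (d.mapDomain σ).degree = n ∧ ∀ i, (d.mapDomain σ) i ≤ 1 then (1 : R) else 0) =
        if d.degree = n ∧ ∀ i, d i ≤ 1 then 1 else 0
      rw [Finsupp.degree_mapDomain]
      refine if_congr (and_congr_right fun _ => ⟨fun h i => ?_, fun h i => ?_⟩) rfl rfl
      · have := h (σ i)
        rwa [Finsupp.mapDomain_apply σ.injective] at this
      · rw [Finsupp.mapDomain_equiv_apply]
        exact h _⟩

variable (R) in
/-- The monomial symmetric function `m μ`: the sum of all monomials whose multiset of nonzero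
exponents is the multiset of parts of the partition `μ`. -/
noncomputable def m {n : ℕ} (μ : n.Partition) : SymmFun R :=
  ⟨fun d => if exponents d = μ.parts then 1 else 0, by
    apply mem_of_coeff _ n
    · intro d hd
      refine if_neg fun h => hd.ne' ?_
      rw [← sum_exponents, h, μ.parts_sum]
    · intro σ d
      change (if exponents (d.mapDomain σ) = μ.parts then (1 : R) else 0) =
        if exponents d = μ.parts then 1 else 0
      rw [exponents_mapDomain]⟩

variable (R) in
/-- `h μ` is the product of the `h i` over the parts `i` of the partition `μ`. -/
noncomputable def hPart {n : ℕ} (μ : n.Partition) : SymmFun R := (μ.parts.map (h R)).prod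

variable (R) in
theorem coeff_h (n : ℕ) (d : ℕ →₀ ℕ) : MvPowerSeries.coeff d (h R n : MvPowerSeries ℕ R) =
    if d.degree = n then 1 else 0 := rfl

open Classical in
variable (R) in
theorem coeff_e (n : ℕ) (d : ℕ →₀ ℕ) : MvPowerSeries.coeff d (e R n : MvPowerSeries ℕ R) =
    if d.degree = n ∧ ∀ i, d i ≤ 1 then 1 else 0 := rfl

variable (R) in
theorem coeff_m {n : ℕ} (μ : n.Partition) (d : ℕ →₀ ℕ) :
    MvPowerSeries.coeff d (m R μ : MvPowerSeries ℕ R) =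
      if exponents d = μ.parts then 1 else 0 := rfl

/-! The fundamental theorem: `SymmFun R` is the polynomial ring in `e 1, e 2, …`. -/

variable (R) in
/-- The algebra homomorphism `R[X 0, X 1, …] → SymmFun R` with `X i ↦ e (i + 1)`. -/
noncomputable def eHom : MvPolynomial ℕ R →ₐ[R] SymmFun R :=
  MvPolynomial.aeval fun i => e R (i + 1)

variable (R) in
/-- Setting the variables `x i`, `i ≥ N`, to zero. -/
noncomputable def restrict (N : ℕ) : SymmFun R →ₐ[R] MvPowerSeries (Fin N) R :=
  (MvPowerSeries.killCompl (R := R) (Fin.valEmbedding (n := N))).comp (SymmFun R).val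

theorem coeff_restrict (N : ℕ) (f : SymmFun R) (d : Fin N →₀ ℕ) :
    MvPowerSeries.coeff d (restrict R N f) =
      MvPowerSeries.coeff (d.embDomain Fin.valEmbedding) (f : MvPowerSeries ℕ R) := rfl

theorem degree_embDomain (N : ℕ) (d : Fin N →₀ ℕ) :
    (d.embDomain Fin.valEmbedding).degree = d.degree := by
  rw [Finsupp.embDomain_eq_mapDomain, Finsupp.degree_mapDomain]

open Classical in
variable (R) in
theorem coeff_esymm (N n : ℕ) (d : Fin N →₀ ℕ) :
    MvPolynomial.coeff d (MvPolynomial.esymm (Fin N) R n) =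
      if d.degree = n ∧ ∀ i, d i ≤ 1 then 1 else 0 := by
  rw [MvPolynomial.esymm_eq_sum_monomial, MvPolynomial.coeff_sum]
  simp_rw [MvPolynomial.coeff_monomial]
  have key : ∀ t : Finset (Fin N), ∀ i, (∑ j ∈ t, Finsupp.single j 1 : Fin N →₀ ℕ) i =
      if i ∈ t then 1 else 0 := by
    intro t i
    simp [Finsupp.finsetSum_apply, Finsupp.single_apply]
  split_ifs with hd
  · have hs : ∀ t : Finset (Fin N), (∑ j ∈ t, Finsupp.single j 1 : Fin N →₀ ℕ) = d ↔
        t = d.support := by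
      intro t
      constructor
      · rintro rfl
        ext i
        rw [Finsupp.mem_support_iff, key]
        simp
      · rintro rfl
        ext i
        rw [key]
        have := hd.2 i
        by_cases h0 : d i = 0
        · simp [h0]
        · rw [if_pos (by simpa using h0)]; omega
    simp_rw [hs]
    rw [Finset.sum_ite_eq', if_pos]
    rw [Finset.mem_powersetCard_univ, Finset.card_eq_sum_ones, ← hd.1, Finsupp.degree_apply]
    refine Finset.sum_congr rfl fun i hi => ?_
    have := hd.2 i
    rw [Finsupp.mem_support_iff] at hi
    omega
  · refine Finset.sum_eq_zero fun t ht => if_neg ?_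
    rintro rfl
    refine hd ⟨?_, fun i => ?_⟩
    · rw [map_sum]
      simp only [Finsupp.degree_single, Finset.sum_const, smul_eq_mul, mul_one]
      exact Finset.mem_powersetCard_univ.1 ht
    · rw [key]; split_ifs <;> omega

variable (R) in
theorem restrict_e (N n : ℕ) :
    restrict R N (e R n) = (MvPolynomial.esymm (Fin N) R n : MvPowerSeries (Fin N) R) := by
  classical
  ext d
  rw [coeff_restrict, coeff_e, MvPolynomial.coeff_coe, coeff_esymm, degree_embDomain]
  refine if_congr (and_congr_right fun _ => ⟨fun h i => ?_, fun h i => ?_⟩) rfl rfl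
  · have := h (Fin.valEmbedding i)
    rwa [Finsupp.embDomain_apply_self] at this
  · by_cases hi : i ∈ Set.range (Fin.valEmbedding (n := N))
    · obtain ⟨j, rfl⟩ := hi
      rw [Finsupp.embDomain_apply_self]; exact h j
    · rw [Finsupp.embDomain_of_notMem_range _ _ _ hi]; omega

theorem restrict_eHom_rename (N : ℕ) (P : MvPolynomial (Fin N) R) :
    restrict R N (eHom R (MvPolynomial.rename Fin.val P)) =
      ((MvPolynomial.esymmAlgHom (Fin N) R N P : MvPolynomial (Fin N) R) :
        MvPowerSeries (Fin N) R) := by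
  have : ((restrict R N).comp (eHom R)).comp (MvPolynomial.rename Fin.val) =
      ((MvPolynomial.coeToMvPowerSeries.algHom R).comp
        (MvPolynomial.symmetricSubalgebra (Fin N) R).val).comp
          (MvPolynomial.esymmAlgHom (Fin N) R N) := by
    apply MvPolynomial.algHom_ext
    intro i
    simp [eHom, MvPolynomial.esymmAlgHom, restrict_e]
  have h := DFunLike.congr_fun this P
  simpa using h

variable (R) in
theorem eHom_injective : Function.Injective (eHom R) := by
  rw [injective_iff_map_eq_zero]
  intro p hp
  obtain ⟨N, hN⟩ : ∃ N, ∀ i ∈ p.vars, i < N :=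
    ⟨p.vars.sup id + 1, fun i hi => Nat.lt_succ_of_le (Finset.le_sup (f := id) hi)⟩
  obtain ⟨q, rfl⟩ := MvPolynomial.exists_rename_eq_of_vars_subset_range p (Fin.val (n := N))
    Fin.val_injective (fun i hi => ⟨⟨i, hN i hi⟩, rfl⟩)
  have h := restrict_eHom_rename N q
  rw [hp, map_zero] at h
  have h' : (MvPolynomial.esymmAlgHom (Fin N) R N q : MvPolynomial (Fin N) R) = 0 := by
    apply MvPolynomial.coe_injective
    rw [← h, MvPolynomial.coe_zero]
  have h2 : q = 0 := by
    apply MvPolynomial.esymmAlgHom_fin_injective R le_rfl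
    rw [map_zero]
    exact Subtype.ext h'
  rw [h2, map_zero]

/-- All monomials occurring in `f` have degree `k`. -/
def IsHomog (f : SymmFun R) (k : ℕ) : Prop :=
  ∀ d : ℕ →₀ ℕ, d.degree ≠ k → MvPowerSeries.coeff d (f : MvPowerSeries ℕ R) = 0

theorem IsHomog.mul {f g : SymmFun R} {k l : ℕ} (hf : IsHomog f k) (hg : IsHomog g l) :
    IsHomog (f * g) (k + l) := by
  classical
  intro d hd
  rw [MulMemClass.coe_mul, MvPowerSeries.coeff_mul]
  refine Finset.sum_eq_zero fun p hp => ?_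
  rw [Finset.HasAntidiagonal.mem_antidiagonal] at hp
  have h : p.1.degree + p.2.degree = d.degree := by rw [← map_add, hp]
  by_cases h1 : p.1.degree = k
  · rw [hg _ (by omega), mul_zero]
  · rw [hf _ h1, zero_mul]

variable (R) in
theorem isHomog_one : IsHomog (1 : SymmFun R) 0 := by
  classical
  intro d hd
  rw [OneMemClass.coe_one, MvPowerSeries.coeff_one, if_neg]
  rintro rfl
  simp at hd

variable (R) in
theorem isHomog_e (n : ℕ) : IsHomog (e R n) n := by
  classical
  intro d hd
  rw [coeff_e, if_neg fun h => hd h.1]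

theorem isHomog_eHom_monomial (a : ℕ →₀ ℕ) (c : R) :
    IsHomog (eHom R (MvPolynomial.monomial a c)) (Finsupp.weight (fun i : ℕ => i + 1) a) := by
  induction a using Finsupp.induction_linear generalizing c with
  | zero =>
    intro d hd
    rw [MvPolynomial.monomial_zero', ← MvPolynomial.algebraMap_eq, AlgHom.commutes]
    rw [Algebra.algebraMap_eq_smul_one, SetLike.val_smul, MvPowerSeries.coeff_smul,
      isHomog_one R d (by simpa using hd), mul_zero]
  | add a b ha hb =>
    have := (ha c).mul (hb 1)
    rwa [← map_mul, MvPolynomial.monomial_mul, mul_one, ← map_add] at this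
  | single i k =>
    have hk : IsHomog (e R (i + 1) ^ k) (k * (i + 1)) := by
      induction k with
      | zero => simpa using isHomog_one R
      | succ k ih => rw [pow_succ, Nat.succ_mul]; exact ih.mul (isHomog_e R _)
    intro d hd
    rw [Finsupp.weight_single, smul_eq_mul] at hd
    have h1 : eHom R (MvPolynomial.monomial (Finsupp.single i k) c) = c • e R (i + 1) ^ k := by
      rw [eHom, MvPolynomial.aeval_monomial, Finsupp.prod_single_index (h := fun i k => e R (i + 1) ^ k) (pow_zero _), Algebra.smul_def]
    rw [h1, SetLike.val_smul, MvPowerSeries.coeff_smul, hk d hd, mul_zero]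

theorem coeff_eHom_component (P : MvPolynomial ℕ R) (k : ℕ) (d : ℕ →₀ ℕ) :
    MvPowerSeries.coeff d (eHom R (MvPolynomial.weightedHomogeneousComponent
      (fun i : ℕ => i + 1) k P) : MvPowerSeries ℕ R) =
    if d.degree = k then MvPowerSeries.coeff d (eHom R P : MvPowerSeries ℕ R) else 0 := by
  classical
  induction P using MvPolynomial.induction_on' with
  | add p q hp hq =>
    rw [map_add, map_add, map_add, AddMemClass.coe_add, AddMemClass.coe_add, map_add, map_add,
      hp, hq]
    split_ifs <;> simp
  | monomial a c =>
    rw [MvPolynomial.weightedHomogeneousComponent_of_mem (n := Finsupp.weight _ a)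
      (MvPolynomial.isWeightedHomogeneous_monomial _ _ _ rfl)]
    split_ifs with h1 h2 h2
    · rfl
    · exact isHomog_eHom_monomial a c d (by rw [← h1]; exact h2)
    · rw [isHomog_eHom_monomial a c d (by rw [h2]; exact h1)]; simp
    · simp

/-- A symmetric function of degree at most `N` vanishes if its restriction to `N` variables
does. -/
theorem eq_zero_of_restrict {N : ℕ} (f : SymmFun R)
    (hN : ∀ d : ℕ →₀ ℕ, N < d.degree → MvPowerSeries.coeff d (f : MvPowerSeries ℕ R) = 0)
    (hf : restrict R N f = 0) : f = 0 := by
  apply Subtype.ext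
  ext d
  rw [ZeroMemClass.coe_zero, map_zero]
  rcases lt_or_ge N d.degree with h1 | h1
  · exact hN d h1
  have hcard : d.support.card ≤ N := by
    refine le_trans ?_ h1
    rw [Finsupp.degree_apply, Finset.card_eq_sum_ones]
    refine Finset.sum_le_sum fun i hi => ?_
    rw [Finsupp.mem_support_iff] at hi
    omega
  obtain ⟨σ, hσ⟩ : ∃ σ : Equiv.Perm ℕ, ∀ i ∈ d.support, σ i < N := by
    have := (Equiv.Perm.isMultiplyPretransitive ℕ d.support.card).exists_smul_eq
      ((d.support.equivFin.symm.toEmbedding).trans (Function.Embedding.subtype _))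
      (Fin.valEmbedding)
    obtain ⟨σ, hσ⟩ := this
    refine ⟨σ, fun i hi => ?_⟩
    have h2 := DFunLike.congr_fun hσ (d.support.equivFin ⟨i, hi⟩)
    simp at h2
    rw [h2]
    omega
  rw [← coeff_mapDomain f σ d]
  obtain ⟨d', hd'⟩ : ∃ d' : Fin N →₀ ℕ, d'.embDomain Fin.valEmbedding = d.mapDomain σ := by
    refine ⟨(d.mapDomain σ).comapDomain Fin.val Fin.val_injective.injOn, ?_⟩
    ext i
    by_cases hi : i < N
    · have := Finsupp.embDomain_apply_self (Fin.valEmbedding (n := N))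
        ((d.mapDomain σ).comapDomain Fin.val Fin.val_injective.injOn) ⟨i, hi⟩
      simpa using this
    · rw [Finsupp.embDomain_of_notMem_range]
      · rw [Finsupp.mapDomain_equiv_apply]
        by_contra hne
        have h3 := hσ (σ.symm i) (by rw [Finsupp.mem_support_iff]; exact fun h => hne h.symm)
        simp at h3
        omega
      · rintro ⟨j, rfl⟩
        exact hi j.2
  rw [← hd', ← coeff_restrict, hf, map_zero]

variable (R) in
theorem eHom_surjective : Function.Surjective (eHom R) := by
  classical
  intro f
  obtain ⟨N, hN⟩ := f.2.1
  have hfin : {d : Fin N →₀ ℕ | d.degree ≤ N}.Finite := Finsupp.finite_of_degree_le N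
  let g : MvPolynomial (Fin N) R :=
    MvPowerSeries.truncFinset R hfin.toFinset (restrict R N f)
  have hg : (g : MvPowerSeries (Fin N) R) = restrict R N f := by
    ext d
    rw [MvPolynomial.coeff_coe, MvPowerSeries.coeff_truncFinset]
    split_ifs with h1
    · rfl
    · rw [coeff_restrict, hN]
      rw [degree_embDomain]
      simpa using h1
  have hsymm : g.IsSymmetric := by
    intro σ
    ext d
    have hd : d = (d.mapDomain σ.symm).mapDomain σ := by
      rw [← Finsupp.mapDomain_comp]
      simp [Finsupp.mapDomain_id]
    conv_lhs => rw [hd]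
    rw [MvPolynomial.coeff_rename_mapDomain _ σ.injective]
    rw [← MvPolynomial.coeff_coe, ← MvPolynomial.coeff_coe, hg, coeff_restrict, coeff_restrict]
    set τ : Equiv.Perm ℕ := Equiv.Perm.viaEmbedding σ.symm Fin.valEmbedding with hτ
    rw [← coeff_mapDomain f τ (d.embDomain _)]
    congr 1
    rw [Finsupp.embDomain_eq_mapDomain, Finsupp.embDomain_eq_mapDomain, ← Finsupp.mapDomain_comp,
      ← Finsupp.mapDomain_comp]
    congr 2
    funext i
    simp only [Function.comp]
    rw [hτ, Equiv.Perm.viaEmbedding_apply]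
  obtain ⟨P, hP⟩ := (MvPolynomial.esymmAlgHom_fin_bijective R N).2 ⟨g, hsymm⟩
  have hres := restrict_eHom_rename N P
  rw [hP, hg] at hres
  set Q := MvPolynomial.rename Fin.val P with hQ
  refine ⟨∑ k ∈ Finset.range (N + 1), MvPolynomial.weightedHomogeneousComponent
    (fun i : ℕ => i + 1) k Q, ?_⟩
  set F := eHom R (∑ k ∈ Finset.range (N + 1), MvPolynomial.weightedHomogeneousComponent
    (fun i : ℕ => i + 1) k Q) with hF
  have hc : ∀ d : ℕ →₀ ℕ, MvPowerSeries.coeff d (F : MvPowerSeries ℕ R) =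
      if d.degree ≤ N then MvPowerSeries.coeff d (eHom R Q : MvPowerSeries ℕ R) else 0 := by
    intro d
    rw [hF, map_sum, AddSubmonoidClass.coe_finsetSum, map_sum]
    simp_rw [coeff_eHom_component]
    rw [Finset.sum_ite_eq]
    simp
  rw [← sub_eq_zero]
  apply eq_zero_of_restrict (N := N)
  · intro d hd
    rw [AddSubgroupClass.coe_sub, map_sub, hc, if_neg (by omega), hN d hd, sub_zero]
  · rw [map_sub, sub_eq_zero]
    ext d
    by_cases hd : d.degree ≤ N
    · rw [← hres, coeff_restrict, coeff_restrict, hc, degree_embDomain, if_pos hd]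
    · rw [coeff_restrict, coeff_restrict, hc, degree_embDomain, if_neg hd, hN]
      rw [degree_embDomain]
      omega

variable (R) in
/-- The isomorphism `R[X 0, X 1, …] ≃ SymmFun R` with `X i ↦ e (i + 1)`. -/
noncomputable def eEquiv : MvPolynomial ℕ R ≃ₐ[R] SymmFun R :=
  AlgEquiv.ofBijective (eHom R) ⟨eHom_injective R, eHom_surjective R⟩

/-! The involution `ω` and the Hall scalar product. -/

variable (R) in
/-- The standard involution `ω`: the ring endomorphism of `SymmFun R` with `ω (e n) = h n`
for all `n`. -/
noncomputable def omegaInv : SymmFun R →ₐ[R] SymmFun R :=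
  (MvPolynomial.aeval fun i => h R (i + 1)).comp (eEquiv R).symm.toAlgHom

variable (R) in
theorem e_zero : e R 0 = 1 := by
  classical
  apply Subtype.ext
  ext d
  rw [coeff_e, OneMemClass.coe_one, MvPowerSeries.coeff_one]
  refine if_congr ⟨fun h => ?_, fun h => ?_⟩ rfl rfl
  · exact Finsupp.degree_eq_zero_iff d |>.1 h.1
  · subst h; simp

variable (R) in
theorem h_zero : h R 0 = 1 := by
  classical
  apply Subtype.ext
  ext d
  rw [coeff_h, OneMemClass.coe_one, MvPowerSeries.coeff_one]
  refine if_congr ⟨fun h => ?_, fun h => ?_⟩ rfl rfl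
  · exact Finsupp.degree_eq_zero_iff d |>.1 h
  · subst h; simp

variable (R) in
theorem omegaInv_e (n : ℕ) : omegaInv R (e R n) = h R n := by
  cases n with
  | zero => rw [e_zero, h_zero, map_one]
  | succ n =>
    have : (eEquiv R).symm (e R (n + 1)) = MvPolynomial.X n := by
      rw [AlgEquiv.symm_apply_eq]
      simp [eEquiv, eHom]
    simp [omegaInv, this]

variable (R) in
theorem sum_e_mul_h (n : ℕ) :
    ∑ p ∈ Finset.HasAntidiagonal.antidiagonal (n + 1), (-1 : R) ^ p.1 • (e R p.1 * h R p.2) = 0 := by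
  classical
  apply Subtype.ext
  ext d
  rw [AddSubmonoidClass.coe_finsetSum, map_sum, ZeroMemClass.coe_zero, map_zero]
  simp_rw [SetLike.val_smul, MvPowerSeries.coeff_smul, MulMemClass.coe_mul,
    MvPowerSeries.coeff_mul, coeff_e, coeff_h]
  by_cases hd : d.degree = n + 1
  swap
  · refine Finset.sum_eq_zero fun p hp => ?_
    rw [Finset.sum_eq_zero, mul_zero]
    intro x hx
    rw [Finset.HasAntidiagonal.mem_antidiagonal] at hp hx
    have h : x.1.degree + x.2.degree = d.degree := by rw [← map_add, hx]
    by_cases h1 : x.1.degree = p.1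
    · rw [if_neg (c := x.2.degree = p.2) (by omega), mul_zero]
    · rw [if_neg (c := x.1.degree = p.1 ∧ _) (fun h => h1 h.1), zero_mul]
  simp_rw [Finset.mul_sum]
  rw [Finset.sum_comm]
  have step : ∀ x ∈ Finset.HasAntidiagonal.antidiagonal d, (∑ p ∈ Finset.HasAntidiagonal.antidiagonal (n + 1), (-1 : R) ^ p.1 *
      ((if x.1.degree = p.1 ∧ ∀ i, x.1 i ≤ 1 then 1 else 0) *
        if x.2.degree = p.2 then 1 else 0)) =
      if ∀ i, x.1 i ≤ 1 then (-1) ^ x.1.degree else 0 := by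
    intro x hx
    rw [Finset.HasAntidiagonal.mem_antidiagonal] at hx
    have h : x.1.degree + x.2.degree = d.degree := by rw [← map_add, hx]
    rw [Finset.sum_eq_single (x.1.degree, x.2.degree)]
    · by_cases h1 : ∀ i, x.1 i ≤ 1 <;> simp [h1]
    · rintro ⟨a, b⟩ - hab
      by_cases h1 : x.1.degree = a
      · rw [if_neg (c := x.2.degree = _), mul_zero, mul_zero]
        rintro rfl
        exact hab (by rw [h1])
      · rw [if_neg (c := x.1.degree = a ∧ _) (fun h => h1 h.1), zero_mul, mul_zero]
    · intro h2
      rw [Finset.HasAntidiagonal.mem_antidiagonal] at h2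
      omega
  rw [Finset.sum_congr rfl step, ← Finset.sum_filter]
  have hne : d.support.Nonempty := by
    rw [Finsupp.support_nonempty_iff]
    rintro rfl
    simp at hd
  have hpow : ∑ t ∈ d.support.powerset, (-1 : R) ^ t.card = 0 := by
    exact_mod_cast congrArg (Int.cast : ℤ → R)
      (Finset.sum_powerset_neg_one_pow_card_of_nonempty hne)
  rw [← hpow]
  have key : ∀ (t : Finset ℕ) (i : ℕ), (∑ j ∈ t, Finsupp.single j 1 : ℕ →₀ ℕ) i =
      if i ∈ t then 1 else 0 := by
    intro t i
    simp [Finsupp.finsetSum_apply, Finsupp.single_apply]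
  have hle : ∀ t ⊆ d.support, (∑ j ∈ t, Finsupp.single j 1 : ℕ →₀ ℕ) ≤ d := by
    intro t ht i
    rw [key]
    split_ifs with hi
    · have := ht hi
      rw [Finsupp.mem_support_iff] at this
      omega
    · omega
  refine Finset.sum_bij' (fun x _ => x.1.support)
    (fun t _ => (∑ j ∈ t, Finsupp.single j 1, d - ∑ j ∈ t, Finsupp.single j 1)) ?_ ?_ ?_ ?_ ?_
  · intro x hx
    rw [Finset.mem_filter, Finset.HasAntidiagonal.mem_antidiagonal] at hx
    rw [Finset.mem_powerset, ← hx.1]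
    intro i hi
    rw [Finsupp.mem_support_iff] at hi ⊢
    simp [hi]
  · intro t ht
    rw [Finset.mem_powerset] at ht
    rw [Finset.mem_filter, Finset.HasAntidiagonal.mem_antidiagonal]
    refine ⟨add_tsub_cancel_of_le (hle t ht), fun i => ?_⟩
    rw [key]
    split_ifs <;> omega
  · intro x hx
    rw [Finset.mem_filter, Finset.HasAntidiagonal.mem_antidiagonal] at hx
    have h1 : (∑ j ∈ x.1.support, Finsupp.single j 1 : ℕ →₀ ℕ) = x.1 := by
      ext i
      rw [key]
      have := hx.2 i
      by_cases h0 : x.1 i = 0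
      · simp [h0]
      · rw [if_pos (by simpa using h0)]; omega
    refine Prod.ext h1 ?_
    change d - _ = x.2
    rw [h1, ← hx.1, add_tsub_cancel_left]
  · intro t ht
    ext i
    rw [Finsupp.mem_support_iff, key]
    simp
  · intro x hx
    rw [Finset.mem_filter] at hx
    congr 1
    rw [Finsupp.degree_apply, Finset.card_eq_sum_ones]
    refine Finset.sum_congr rfl fun i hi => ?_
    have := hx.2 i
    rw [Finsupp.mem_support_iff] at hi
    omega

variable (R) in
theorem omegaInv_h (n : ℕ) : omegaInv R (h R n) = e R n := by
  induction n using Nat.strong_induction_on with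
  | _ n ih =>
  cases n with
  | zero => rw [e_zero, h_zero, map_one]
  | succ n =>
    have h1 := congrArg (omegaInv R) (sum_e_mul_h R n)
    rw [map_sum, map_zero] at h1
    have h2 := sum_e_mul_h R n
    rw [← Finset.Nat.sum_antidiagonal_swap] at h2
    have h3 : ∑ p ∈ Finset.HasAntidiagonal.antidiagonal (n + 1), (-1 : R) ^ p.1 • (h R p.1 * e R p.2) = 0 := by
      rw [← smul_zero ((-1 : R) ^ (n + 1)), ← h2, Finset.smul_sum]
      refine Finset.sum_congr rfl fun p hp => ?_
      rw [Finset.HasAntidiagonal.mem_antidiagonal] at hp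
      rw [smul_smul, ← hp, Prod.fst_swap, Prod.snd_swap, pow_add, mul_assoc, ← pow_add,
        ← two_mul, pow_mul, neg_one_sq, one_pow, mul_one, mul_comm (e R _)]
    simp_rw [map_smul, map_mul, omegaInv_e] at h1
    rw [← sub_eq_zero, ← sub_zero (_ - _)]
    rw [Finset.Nat.sum_antidiagonal_succ] at h1 h3
    have h4 : ∑ p ∈ Finset.HasAntidiagonal.antidiagonal n, (-1 : R) ^ (p.1 + 1) • (h R (p.1 + 1) * omegaInv R (h R p.2)) =
        ∑ p ∈ Finset.HasAntidiagonal.antidiagonal n, (-1 : R) ^ (p.1 + 1) • (h R (p.1 + 1) * e R p.2) := by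
      refine Finset.sum_congr rfl fun p hp => ?_
      rw [Finset.HasAntidiagonal.mem_antidiagonal] at hp
      rw [ih p.2 (by omega)]
    rw [h4] at h1
    simp only [pow_zero, one_smul, h_zero, one_mul] at h1 h3
    rw [sub_zero, sub_eq_zero]
    exact add_right_cancel (h1.trans h3.symm)

theorem omegaInv_omega (f : SymmFun R) : omegaInv R (omegaInv R f) = f := by
  have h1 : ((omegaInv R).comp (omegaInv R)).comp (eHom R) = eHom R := by
    apply MvPolynomial.algHom_ext
    intro i
    simp [eHom, omegaInv_e, omegaInv_h]
  obtain ⟨P, rfl⟩ := eHom_surjective R f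
  exact DFunLike.congr_fun h1 P

variable (R) in
/-- The isomorphism `R[X 0, X 1, …] ≃ SymmFun R` with `X i ↦ h (i + 1)`. -/
noncomputable def hEquiv : MvPolynomial ℕ R ≃ₐ[R] SymmFun R :=
  (eEquiv R).trans (AlgEquiv.ofAlgHom (omegaInv R) (omegaInv R) (AlgHom.ext omegaInv_omega) (AlgHom.ext omegaInv_omega))

variable (R) in
theorem hEquiv_X (i : ℕ) : hEquiv R (MvPolynomial.X i) = h R (i + 1) := by
  have : eEquiv R (MvPolynomial.X i) = e R (i + 1) := by simp [eEquiv, eHom]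
  simp [hEquiv, this, omegaInv_e]

variable (R) in
/-- The basis of `SymmFun R` whose member at `a` is `∏ i, h (i + 1) ^ a i`, the complete
homogeneous symmetric function of the partition with `a i` parts equal to `i + 1`. -/
noncomputable def hBasis : Module.Basis (ℕ →₀ ℕ) R (SymmFun R) :=
  (MvPolynomial.basisMonomials ℕ R).map (hEquiv R).toLinearEquiv

/-- The multiset of parts with `a i` parts equal to `i + 1`. -/
noncomputable def partsOf (a : ℕ →₀ ℕ) : Multiset ℕ := (Finsupp.toMultiset a).map (· + 1)

/-- The exponent of the monomial `x 0 ^ s₀ * x 1 ^ s₁ * ⋯`, with `s₀ ≥ s₁ ≥ ⋯` the elements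
of `s`. -/
noncomputable def leadingExponent (s : Multiset ℕ) : ℕ →₀ ℕ := (s.sort (· ≥ ·)).toFinsupp

variable (R) in
/-- The linear functional taking a symmetric function to its coefficient at the monomial symmetric
function whose partition has the parts `s`. -/
noncomputable def mCoeff (s : Multiset ℕ) : SymmFun R →ₗ[R] R :=
  (MvPowerSeries.coeff (leadingExponent s)).comp (SymmFun R).val.toLinearMap

variable (R) in
/-- The Hall scalar product: the bilinear form for which the monomial and the complete homogeneous
symmetric functions are dual bases. -/
noncomputable def hall : SymmFun R →ₗ[R] SymmFun R →ₗ[R] R :=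
  ((hBasis R).constr R fun a => mCoeff R (partsOf a)).flip

theorem exponents_leadingExponent (s : Multiset ℕ) (hs : ∀ i ∈ s, 0 < i) :
    exponents (leadingExponent s) = s := by
  have hl : ∀ i ∈ s.sort (· ≥ ·), 0 < i := fun i hi => hs i ((Multiset.mem_sort _).1 hi)
  conv_rhs => rw [← Multiset.sort_eq s (· ≥ ·)]
  rw [leadingExponent]
  generalize s.sort (· ≥ ·) = l at hl
  have hsupp : l.toFinsupp.support = Finset.range l.length := by
    rw [List.toFinsupp_support, Finset.filter_eq_self]
    intro i hi
    rw [Finset.mem_range] at hi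
    rw [List.getD_eq_getElem _ _ hi]
    exact (hl _ (List.getElem_mem hi)).ne'
  rw [exponents, hsupp, Finset.range_val, Multiset.range, Multiset.map_coe]
  congr 1
  apply List.ext_getElem
  · simp
  · intro i h1 h2
    simp [List.toFinsupp_apply_lt _ _ h2]

variable (R) in
/-- The defining property of the Hall scalar product. -/
theorem hall_m_hPart {k n : ℕ} (mu : k.Partition) (nu : n.Partition) :
    hall R (m R mu) (hPart R nu) = if nu.parts = mu.parts then 1 else 0 := by
  set a : ℕ →₀ ℕ := Multiset.toFinsupp (nu.parts.map (· - 1)) with ha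
  have h1 : partsOf a = nu.parts := by
    rw [partsOf, ha, Multiset.toFinsupp_toMultiset, Multiset.map_map]
    conv_rhs => rw [← Multiset.map_id nu.parts]
    refine Multiset.map_congr rfl fun i hi => ?_
    have := nu.parts_pos hi
    simp only [Function.comp, id]
    omega
  have h2 : hPart R nu = hBasis R a := by
    have : hBasis R a = hEquiv R (MvPolynomial.monomial a 1) := by
      rw [hBasis, Module.Basis.map_apply, MvPolynomial.coe_basisMonomials]
      rfl
    rw [this, MvPolynomial.monomial_eq, MvPolynomial.C_1, one_mul, Finsupp.prod, map_prod, hPart,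
      ← h1, partsOf, Multiset.map_map]
    rw [Finset.prod_multiset_map_count]
    simp [hEquiv_X]
  rw [h2, hall, LinearMap.flip_apply, Module.Basis.constr_basis, h1]
  change MvPowerSeries.coeff _ (m R mu : MvPowerSeries ℕ R) = _
  rw [coeff_m, exponents_leadingExponent _ fun i hi => nu.parts_pos hi]

end SymmFun

/-! Chromatic quasisymmetric functions. Vertices `1, …, n` are the elements of `Fin n`, and colors
are natural numbers, color `c` contributing the variable `x c`. -/

namespace SimpleGraph

variable {n : ℕ} {G : SimpleGraph (Fin n)}

/-- The exponent of the monomial `∏ v, x (κ v)` of a coloring. -/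
noncomputable def Coloring.content (κ : G.Coloring ℕ) : ℕ →₀ ℕ := ∑ v, Finsupp.single (κ v) 1

/-- The number of edges `{i, j}` with `i < j` and `κ i < κ j`. -/
noncomputable def Coloring.asc (κ : G.Coloring ℕ) : ℕ :=
  {p : Fin n × Fin n | G.Adj p.1 p.2 ∧ p.1 < p.2 ∧ κ p.1 < κ p.2}.ncard

theorem Coloring.finite_content_eq (d : ℕ →₀ ℕ) :
    {κ : G.Coloring ℕ | κ.content = d}.Finite := by
  have hfin : (Set.univ.pi fun _ : Fin n => (d.support : Set ℕ)).Finite :=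
    Set.Finite.pi fun _ => d.support.finite_toSet
  refine Set.Finite.of_finite_image (f := fun (κ : G.Coloring ℕ) (v : Fin n) => κ v)
    (hfin.subset ?_) fun κ _ κ' _ h => DFunLike.coe_injective h
  rintro _ ⟨κ, rfl, rfl⟩ v -
  have h : (Finsupp.single (κ v) 1 : ℕ →₀ ℕ) ≤ κ.content :=
    Finset.single_le_sum (f := fun v => (Finsupp.single (κ v) 1 : ℕ →₀ ℕ))
      (fun _ _ => zero_le) (Finset.mem_univ v)
  have h1 := h (κ v)
  rw [Finsupp.single_eq_same] at h1
  rw [Finset.mem_coe, Finsupp.mem_support_iff]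
  change κ.content (κ v) ≠ 0
  omega

/-- The chromatic quasisymmetric function `X_G(x; t) = ∑ κ, t ^ asc κ * x_κ`, the sum being over
all proper colorings of `G`: its coefficient at a monomial is the sum of `t ^ asc κ` over
the (finitely many) proper colorings `κ` with that monomial. -/
noncomputable def chromaticQuasisymmetric {R : Type*} [CommRing R] (G : SimpleGraph (Fin n))
    (t : R) : MvPowerSeries ℕ R :=
  fun d => ∑ᶠ κ ∈ {κ : G.Coloring ℕ | κ.content = d}, t ^ κ.asc

end SimpleGraph

/-! Hessenberg functions and Hessenberg varieties. -/

/-- A Hessenberg function: a weakly increasing function with `i ≤ m i` for all `i`. -/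
structure IsHessenberg {n : ℕ} (m : Fin n → Fin n) : Prop where
  monotone : Monotone m
  le_apply : ∀ i, i ≤ m i

/-- The indifference graph of `m`, with edges `{i, j}` for `i < j ≤ m i`. -/
def indifferenceGraph {n : ℕ} (m : Fin n → Fin n) : SimpleGraph (Fin n) :=
  SimpleGraph.fromRel fun i j => i < j ∧ j ≤ m i

/-- The Hessenberg variety (its set of points over the base field): complete flags
`V₁ ⊆ V₂ ⊆ ⋯ ⊆ Vₙ = Fⁿ` with `T Vᵢ ⊆ V_{m(i)}`. The member of the flag at `i : Fin n` has
dimension `i + 1`. -/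
def hessenbergVariety {F : Type*} [Field F] {n : ℕ} (m : Fin n → Fin n)
    (T : (Fin n → F) →ₗ[F] (Fin n → F)) : Set (Fin n → Submodule F (Fin n → F)) :=
  {V | Monotone V ∧ (∀ i : Fin n, Module.finrank F (V i) = i + 1) ∧
    ∀ i : Fin n, (V i).map T ≤ V (m i)}

/-! Invariant flag generating functions. -/

/-- The parts `λ₁ ≥ λ₂ ≥ ⋯ ≥ λ_ℓ` of a partition in weakly decreasing order. -/
def Nat.Partition.partsList {n : ℕ} (mu : n.Partition) : List ℕ := mu.parts.sort (· ≥ ·)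

/-- The `λ`-flags of `T`-invariant subspaces: sequences `0 = W₀ ⊆ W₁ ⊆ ⋯ ⊆ W_ℓ` of `T`-invariant
subspaces with `dim Wᵢ / Wᵢ₋₁ = λᵢ` for `1 ≤ i ≤ ℓ`. -/
def invariantFlags {F : Type*} [Field F] {n : ℕ} (T : (Fin n → F) →ₗ[F] (Fin n → F))
    (mu : n.Partition) : Set (Fin (mu.partsList.length + 1) → Submodule F (Fin n → F)) :=
  {W | W 0 = ⊥ ∧ Monotone W ∧
    (∀ i : Fin mu.partsList.length, Module.finrank F (W i.succ) =
      Module.finrank F (W i.castSucc) + mu.partsList.get i) ∧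
    ∀ i, (W i).map T ≤ W i}

/-- The invariant flag generating function `F_T = ∑ λ ⊢ n, fl_λ(T) m_λ`, where `fl_λ(T)` is
the number of `λ`-flags of `T`-invariant subspaces. -/
noncomputable def invariantFlagGF {F : Type*} [Field F] {n : ℕ}
    (T : (Fin n → F) →ₗ[F] (Fin n → F)) : SymmFun ℤ :=
  ∑ mu : n.Partition, (invariantFlags T mu).ncard • SymmFun.m ℤ mu

/-!
The proof compares the two sides as functions of the Hessenberg function, with `F` and `T` fixed.

Both sides satisfy the modular law of Abreu and Nigro (`ModularLaw`), a linear relation between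
the values at certain triples of Hessenberg functions. For the number of points of a Hessenberg
variety (`modularLaw_card_hessenbergFlags`) it is an elementary count: all members of the flag but
one are held fixed, and the remaining one runs through the `q + 1` subspaces strictly between its
two neighbours, of which `0`, `1` or `q + 1` satisfy the condition that has changed. For the
chromatic quasisymmetric function (`modularLaw_coeff_chromaticSeries`) it holds coefficient by
coefficient: exchanging the colors of two vertices with the same further neighbours reduces it to an
identity between the weights of the edges of a triangle.

A function with the modular law that vanishes at the idempotent Hessenberg functions is zero
(`ModularLaw.eq_zero_of_idempotent`): the law at first reduces the vanishing to graphs whose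
components are paths, and then turns paths into cliques. The graph of an idempotent Hessenberg
function is a disjoint union of cliques on intervals of vertices, of sizes `a₁, …, a_r` say. There
the chromatic quasisymmetric function is the product of the `[aᵢ]! * e aᵢ`, where `[a]!` is the
`q`-factorial (`chromaticSeries_idempotent`). As this is symmetric and the defect of symmetry has
the modular law, all these series are symmetric (`chromaticSeries_mem`).

For an idempotent function, a point of the Hessenberg variety is a chain of invariant subspaces with
jumps `a₁, …, a_r` together with a complete flag in each of the quotients, so that the number of
points is the product of the `[aᵢ]!` times the number of such chains (`chainCount_blockLengths`).
Applying `ω` turns the product of the `e aᵢ` into that of the `h aᵢ`, and pairing with `F_T`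
extracts the number of chains of invariant subspaces with the same jumps in decreasing order. The
order does not matter (`chainCount_perm`), because a linear operator on a finite-dimensional space
has as many invariant subspaces of dimension `k` as of codimension `k`: it is self-adjoint for some
nondegenerate symmetric bilinear form (`exists_selfAdjoint_form`), and orthogonal complements pair
these subspaces off. Here it is applied to the subquotients (`ncard_invariant_between_eq`).
-/

/-! ### The modular law and its solutions -/

/-- The values on `{0, …, n - 1}` of `h : ℕ → ℕ` form a Hessenberg function. Working with
functions on `ℕ` instead of `Fin n` keeps the index arithmetic in `ℕ`; the values `h i` with
`n ≤ i` play no role. -/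
structure HessenbergOn (n : ℕ) (h : ℕ → ℕ) : Prop where
  le_apply : ∀ i < n, i ≤ h i
  apply_lt : ∀ i < n, h i < n
  mono : ∀ i j, i ≤ j → j < n → h i ≤ h j

/-- The modular law of Abreu and Nigro, for an integer-valued function of Hessenberg functions.
In `row` the end of a single row runs through `a`, `a + 1`, `a + 2`. In `col` the vertex `a + 1`
is adjacent, among `i` and `i + 1`, to none, to `i + 1`, and to both. -/
structure ModularLaw (n : ℕ) (q : ℤ) (f : (ℕ → ℕ) → ℤ) : Prop where
  row : ∀ (h : ℕ → ℕ) (i a : ℕ), i < n → HessenbergOn n (Function.update h i a) →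
    HessenbergOn n (Function.update h i (a + 2)) → h (a + 1) = h (a + 2) →
    (1 + q) * f (Function.update h i (a + 1)) =
      q * f (Function.update h i a) + f (Function.update h i (a + 2))
  col : ∀ (h : ℕ → ℕ) (i a : ℕ), i + 1 < n → HessenbergOn n h → h i = a → h (i + 1) = a →
    (∀ j < n, h j ≠ i) →
    HessenbergOn n (Function.update (Function.update h (i + 1) (a + 1)) i (a + 1)) →
    (1 + q) * f (Function.update h (i + 1) (a + 1)) =
      q * f h + f (Function.update (Function.update h (i + 1) (a + 1)) i (a + 1))

namespace ModularLaw

variable {n : ℕ} {q : ℤ} {f : (ℕ → ℕ) → ℤ}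

/-- The key reduction. Suppose that lowering the end of row `u` in any way, with the later rows
arbitrary, leads to zeros of `f`. If row `a = h u` has the same end as row `a - 1`, the row law
applies at `u`; if the two ends differ by one, the column law makes them equal; and otherwise the
same reduction applies to row `a`. This stops, as row `n - 1` has the same end as row `n - 2`. -/
theorem eq_zero_of_lower_eq_zero (hf : ModularLaw n q f) (hq : 0 < q) :
    ∀ (k u : ℕ), n ≤ u + k → ∀ h : ℕ → ℕ, HessenbergOn n h → u < n → u + 2 ≤ h u →
      (∀ i < u, h i + 2 ≤ h u) →
      (∀ h', HessenbergOn n h' → (∀ i < u, h' i = h i) → h' u < h u → f h' = 0) → f h = 0 := by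
  intro k
  induction k with
  | zero => intro u hu h _ hun; omega
  | succ k ih =>
    intro u hu h hh hun hua hlow hzero
    obtain ⟨a, ha⟩ : ∃ a, h u = a + 2 := ⟨h u - 2, by omega⟩
    have han : a + 2 < n := ha ▸ hh.apply_lt u hun
    have key1 : ∀ g, HessenbergOn n g → (∀ i ≤ u, g i = h i) → g (a + 1) = g (a + 2) →
        f g = 0 := by
      intro g hg hgh hga
      have hgu := hgh u le_rfl
      have e : Function.update g u (a + 2) = g := by
        rw [← ha, ← hgu, Function.update_eq_self]
      have hH : ∀ b, a ≤ b → b ≤ a + 2 → HessenbergOn n (Function.update g u b) := by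
        intro b hb hb'
        refine ⟨fun i hi => ?_, fun i hi => ?_, fun i j hij hj => ?_⟩
        · have := hg.le_apply i hi
          rw [Function.update_apply]; split_ifs <;> omega
        · have := hg.apply_lt i hi
          rw [Function.update_apply]; split_ifs <;> omega
        · have h1 := hg.mono i j hij hj
          rw [Function.update_apply, Function.update_apply]
          split_ifs with h2 h3 h3
          · omega
          · subst h2; omega
          · subst h3
            have := hlow i (by omega)
            have := hgh i (by omega)
            omega
          · omega
      have hz : ∀ b, a ≤ b → b < a + 2 → f (Function.update g u b) = 0 := by
        intro b hb hb'
        refine hzero _ (hH b hb hb'.le) (fun i hi => ?_) ?_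
        · rw [Function.update_of_ne hi.ne, hgh i hi.le]
        · rw [Function.update_self]; omega
      have := hf.row g u a hun (hH a le_rfl (by omega)) (hH _ (by omega) le_rfl) hga
      rw [hz a le_rfl (by omega), hz (a + 1) (by omega) (by omega), e] at this
      simpa using this.symm
    suffices key2 : ∀ N g, g (a + 2) ≤ N → HessenbergOn n g → (∀ i ≤ u, g i = h i) → f g = 0 from
      key2 _ h le_rfl hh fun _ _ => rfl
    intro N
    induction N with
    | zero =>
      intro g h1 hg _
      have := hg.le_apply (a + 2) han
      omega
    | succ N ihN =>
      intro g hN hg hgh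
      have hmono := hg.mono (a + 1) (a + 2) (by omega) han
      have hua' : u < a + 1 := by omega
      have ha1 : a + 2 ≤ g (a + 1) := by
        have := hg.mono u (a + 1) (by omega) (by omega)
        rw [hgh u le_rfl] at this; omega
      rcases Nat.lt_or_ge (g (a + 1) + 1) (g (a + 2)) with h2 | h2
      · refine ih (a + 2) (by omega) g hg han (by omega) (fun i hi => ?_) ?_
        · have := hg.mono i (a + 1) (by omega) (by omega)
          omega
        · intro g' hg' hgg' hlt
          refine ihN g' (by omega) hg' fun i hi => ?_
          rw [hgg' i (by omega), hgh i hi]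
      · rcases Nat.eq_or_lt_of_le hmono with h3 | h3
        · exact key1 g hg hgh h3
        · have h4 : g (a + 2) = g (a + 1) + 1 := by omega
          set b := g (a + 1) with hb
          have hbn : b + 1 < n := h4 ▸ hg.apply_lt (a + 2) han
          set g0 := Function.update g (a + 2) b with hg0
          have e1 : Function.update g0 (a + 2) (b + 1) = g := by
            rw [hg0, Function.update_idem, ← h4, Function.update_eq_self]
          have H0 : HessenbergOn n g0 := by
            refine ⟨fun i hi => ?_, fun i hi => ?_, fun i j hij hj => ?_⟩
            · have := hg.le_apply i hi
              rw [hg0, Function.update_apply]; split_ifs <;> omega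
            · have := hg.apply_lt i hi
              rw [hg0, Function.update_apply]; split_ifs <;> omega
            · have h1 := hg.mono i j hij hj
              rw [hg0, Function.update_apply, Function.update_apply]
              split_ifs with h5 h6 h6
              · omega
              · subst h5; omega
              · subst h6
                have := hg.mono i (a + 1) (by omega) (by omega)
                omega
              · omega
          have H2 : HessenbergOn n (Function.update g (a + 1) (b + 1)) := by
            refine ⟨fun i hi => ?_, fun i hi => ?_, fun i j hij hj => ?_⟩
            · have := hg.le_apply i hi
              rw [Function.update_apply]; split_ifs <;> omega
            · have := hg.apply_lt i hi
              rw [Function.update_apply]; split_ifs <;> omega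
            · have h1 := hg.mono i j hij hj
              rw [Function.update_apply, Function.update_apply]
              split_ifs with h5 h6 h6
              · omega
              · subst h5
                have := hg.mono (a + 2) j (by omega) hj
                omega
              · subst h6; omega
              · omega
          have hcol := hf.col g0 (a + 1) b (by omega) H0
            (by rw [hg0, Function.update_of_ne (by omega)])
            (by rw [hg0, Function.update_self]) ?_ (by rw [e1]; exact H2)
          · rw [e1, key1 g0 H0, key1 _ H2] at hcol
            · have : (1 + q) ≠ 0 := by omega
              simpa [this] using hcol
            · intro i hi
              rw [Function.update_of_ne (by omega), hgh i hi]
            · rw [Function.update_self, Function.update_of_ne (by omega), h4]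
            · intro i hi
              rw [hg0, Function.update_of_ne (by omega), hgh i hi]
            · rw [hg0, Function.update_self, Function.update_of_ne (by omega)]
          · intro j hj
            rw [hg0, Function.update_apply]
            split_ifs with h5
            · omega
            · rcases Nat.lt_or_ge j u with h6 | h6
              · have := hlow j h6
                have := hgh j h6.le
                omega
              · have := hg.mono u j h6 hj
                have := hgh u le_rfl
                omega

/-- If `f` vanishes whenever the component of the vertex `s` is a path, it vanishes. -/
theorem eq_zero_of_path (hf : ModularLaw n q f) (hq : 0 < q) {s : ℕ} {P : (ℕ → ℕ) → Prop}
    (hP : ∀ h h', P h → (∀ i < s, h' i = h i) → P h') (hPs : ∀ h, P h → ∀ i < s, h i < s)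
    (hpath : ∀ (h : ℕ → ℕ) (p : ℕ), HessenbergOn n h → P h → s ≤ p → p < n →
      (∀ i, s ≤ i → i < p → h i = i + 1) → h p = p → f h = 0)
    {h : ℕ → ℕ} (hh : HessenbergOn n h) (hPh : P h) (hs : s < n) : f h = 0 := by
  -- Induction on the length of the path that starts at `s`, and on the end of its last row `p`.
  suffices key : ∀ k p, n ≤ p + k → s ≤ p → p < n → ∀ N h, h p ≤ N → HessenbergOn n h → P h →
      (∀ i, s ≤ i → i < p → h i = i + 1) → f h = 0 from
    key n s (by omega) le_rfl hs _ h le_rfl hh hPh fun i _ _ => by omega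
  intro k
  induction k with
  | zero => intro p hp _ hpn; omega
  | succ k ih =>
    intro p hp hsp hpn N
    induction N with
    | zero =>
      intro h h0 hh hPh hi
      have := hh.le_apply p hpn
      exact hpath h p hh hPh hsp hpn hi (by omega)
    | succ N ihN =>
      intro h hN hh hPh hi
      have h1 := hh.le_apply p hpn
      have h2 := hh.apply_lt p hpn
      rcases Nat.lt_or_ge (p + 1) (h p) with h3 | h3
      · refine hf.eq_zero_of_lower_eq_zero hq (n - p) p (by omega) h hh hpn h3 (fun i hip => ?_) ?_
        · rcases Nat.lt_or_ge i s with h4 | h4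
          · have := hPs h hPh i h4
            omega
          · have := hi i h4 hip
            omega
        · intro h' hh' hag hlt
          refine ihN h' (by omega) hh' (hP h h' hPh fun i his => hag i (by omega)) fun i h4 h5 => ?_
          rw [hag i h5, hi i h4 h5]
      · rcases Nat.eq_or_lt_of_le h1 with h4 | h4
        · exact hpath h p hh hPh hsp hpn hi h4.symm
        · refine ih (p + 1) (by omega) (by omega) (by omega) _ h le_rfl hh hPh fun i h5 h6 => ?_
          rcases Nat.lt_or_ge i p with h7 | h7
          · exact hi i h5 h7
          · obtain rfl : i = p := by omega
            omega

/-- A sequence whose differences form a geometric progression of positive ratio is constant as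
soon as two of its members at different places agree. -/
theorem recurrence_eq_zero (hq : 0 < q) {F : ℕ → ℤ} {k : ℕ} (h0 : F 0 = 0)
    (hk : F (k + 1) = 0)
    (hF : ∀ y < k, (1 + q) * F (y + 1) = q * F y + F (y + 2)) : F 1 = 0 := by
  have key : ∀ y ≤ k, F (y + 1) - F y = q ^ y * F 1 := by
    intro y hy
    induction y with
    | zero => simp [h0]
    | succ y ih =>
      have h1 := hF y (by omega)
      have h2 := ih (by omega)
      rw [pow_succ]
      linear_combination -h1 + q * h2
  have hsum : ∑ y ∈ Finset.range (k + 1), q ^ y * F 1 = 0 := by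
    rw [← Finset.sum_congr rfl fun y hy => key y (by simpa [Nat.lt_succ_iff] using hy),
      Finset.sum_range_sub, h0, hk, sub_zero]
  rw [← Finset.sum_mul] at hsum
  have : 0 < ∑ y ∈ Finset.range (k + 1), q ^ y :=
    Finset.sum_pos (fun y _ => by positivity) (by simp)
  rcases mul_eq_zero.1 hsum with h | h
  · omega
  · exact h

/-- If `f` vanishes whenever the component of the vertex `s` is a clique, it vanishes whenever
this component is a clique followed by a path: moving the lower end of the first column after the
clique, with the column law, either enlarges the clique or cuts it off. -/
theorem eq_zero_of_lollipop (hf : ModularLaw n q f) (hq : 0 < q) {s : ℕ} {P : (ℕ → ℕ) → Prop}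
    (hP : ∀ h h', P h → (∀ i < s, h' i = h i) → P h') (hPs : ∀ h, P h → ∀ i < s, h i < s)
    (hclique : ∀ (h : ℕ → ℕ) (e : ℕ), HessenbergOn n h → P h → s ≤ e → e < n →
      (∀ i, s ≤ i → i ≤ e → h i = e) → f h = 0) :
    ∀ (k p e : ℕ), p = e + k → s ≤ e → p < n → ∀ h, HessenbergOn n h → P h →
      (∀ i, s ≤ i → i < e → h i = e) → (∀ i, e ≤ i → i < p → h i = i + 1) → h p = p →
      f h = 0 := by
  intro k
  induction k with
  | zero =>
    intro p e hpe hse hpn h hh hPh h1 _ h3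
    refine hclique h e hh hPh hse (by omega) fun i hi hi' => ?_
    rcases Nat.eq_or_lt_of_le hi' with rfl | h4
    · obtain rfl : p = i := by omega
      exact h3
    · exact h1 i hi h4
  | succ k ih =>
    intro p e hpe hse hpn h hh hPh h1 h2 h3
    have he := h2 e le_rfl (by omega)
    -- In `g y` the vertex `e + 1` is adjacent to the last `y` vertices of the clique
    -- `{s, …, e}`. Thus `g 1 = h`, while `g 0` cuts the clique off and `g (e - s + 1)` enlarges it.
    let g : ℕ → ℕ → ℕ := fun y i =>
      if s ≤ i ∧ i ≤ e then (if e + 1 ≤ i + y then e + 1 else e) else h i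
    have hgdef : ∀ y i, g y i =
      if s ≤ i ∧ i ≤ e then (if e + 1 ≤ i + y then e + 1 else e) else h i := fun _ _ => rfl
    have hgP : ∀ y, P (g y) := fun y => hP h _ hPh fun i hi => by
      rw [hgdef, if_neg (by omega)]
    have hgH : ∀ y, HessenbergOn n (g y) := by
      intro y
      refine ⟨fun i hi => ?_, fun i hi => ?_, fun i j hij hj => ?_⟩
      · have := hh.le_apply i hi
        rw [hgdef]; split_ifs <;> omega
      · have := hh.apply_lt i hi
        rw [hgdef]; split_ifs <;> omega
      · have h4 := hh.mono i j hij hj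
        rw [hgdef, hgdef]
        by_cases hi : s ≤ i ∧ i ≤ e <;> by_cases hj' : s ≤ j ∧ j ≤ e
        · rw [if_pos hi, if_pos hj']; split_ifs <;> omega
        · rw [if_pos hi, if_neg hj']
          have := hh.le_apply j hj
          split_ifs <;> omega
        · rw [if_neg hi, if_pos hj']
          have := hPs h hPh i (by omega)
          split_ifs <;> omega
        · rw [if_neg hi, if_neg hj']; exact h4
    have hg1 : g 1 = h := by
      funext i
      rw [hgdef]
      split_ifs with h4 h5
      · obtain rfl : i = e := by omega
        omega
      · rw [h1 i h4.1 (by omega)]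
      · rfl
    rw [← hg1]
    refine recurrence_eq_zero hq (F := fun y => f (g y)) (k := e - s) ?_ ?_ fun y hy => ?_
    · refine hclique _ e (hgH 0) (hgP 0) hse (by omega) fun i hi hi' => ?_
      rw [hgdef, if_pos ⟨hi, hi'⟩, if_neg (by omega)]
    · refine ih p (e + 1) (by omega) (by omega) hpn _ (hgH _) (hgP _) (fun i hi hi' => ?_)
        (fun i hi hi' => ?_) ?_
      · rw [hgdef, if_pos (by omega), if_pos (by omega)]
      · rw [hgdef, if_neg (by omega), h2 i (by omega) hi']
      · rw [hgdef, if_neg (by omega), h3]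
    · obtain ⟨i, hi⟩ : ∃ i, e = i + 1 + y := ⟨e - 1 - y, by omega⟩
      have e1 : Function.update (g y) (i + 1) (e + 1) = g (y + 1) := by
        funext j
        rw [Function.update_apply, hgdef, hgdef]
        split_ifs <;> omega
      have e2 : Function.update (g (y + 1)) i (e + 1) = g (y + 2) := by
        funext j
        rw [Function.update_apply, hgdef, hgdef]
        split_ifs <;> omega
      have hcol := hf.col (g y) i e (by omega) (hgH y)
        (by rw [hgdef, if_pos (by omega), if_neg (by omega)])
        (by rw [hgdef, if_pos (by omega), if_neg (by omega)]) (fun j hj => ?_)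
        (by rw [e1, e2]; exact hgH _)
      · rwa [e1, e2] at hcol
      · have hj1 := hh.le_apply j hj
        rw [hgdef]
        split_ifs with h4 h5
        · omega
        · omega
        · rcases Nat.lt_or_ge j s with h5 | h5
          · have := hPs h hPh j h5
            omega
          · omega

/-- A function with the modular law is determined by its values on the Hessenberg functions of
disjoint unions of cliques, which are the idempotent ones. -/
theorem eq_zero_of_idempotent (hf : ModularLaw n q f) (hq : 0 < q)
    (hidem : ∀ h, HessenbergOn n h → (∀ i < n, h (h i) = h i) → f h = 0)
    {h : ℕ → ℕ} (hh : HessenbergOn n h) : f h = 0 := by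
  -- Induction on the number of vertices from `s` on; those before `s` form disjoint cliques.
  suffices key : ∀ k s, n ≤ s + k → s ≤ n → ∀ h, HessenbergOn n h →
      ((∀ i < s, h i < s) ∧ ∀ i < s, h (h i) = h i) → f h = 0 from
    key n 0 (by omega) (by omega) h hh ⟨fun i hi => by omega, fun i hi => by omega⟩
  intro k
  induction k with
  | zero =>
    intro s hs hs' h hh hP
    obtain rfl : s = n := by omega
    exact hidem h hh hP.2
  | succ k ih =>
    intro s hs hs' h hh hP
    rcases Nat.eq_or_lt_of_le hs' with rfl | hsn
    · exact hidem h hh hP.2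
    set P : (ℕ → ℕ) → Prop := fun h => (∀ i < s, h i < s) ∧ ∀ i < s, h (h i) = h i with hPdef
    have hP1 : ∀ h h', P h → (∀ i < s, h' i = h i) → P h' := fun h h' hh hag =>
      ⟨fun i hi => by rw [hag i hi]; exact hh.1 i hi, fun i hi => by
        rw [hag i hi, hag _ (hh.1 i hi), hh.2 i hi]⟩
    have hP2 : ∀ h, P h → ∀ i < s, h i < s := fun h hh => hh.1
    refine hf.eq_zero_of_path hq hP1 hP2 (fun h p hh hPh hsp hpn hi hp => ?_) hh hP hsn
    refine hf.eq_zero_of_lollipop hq hP1 hP2 (fun h e hh hPh hse hen hi => ?_) (p - s) p s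
      (by omega) le_rfl hpn h hh hPh (fun i _ _ => by omega) hi hp
    refine ih (e + 1) (by omega) (by omega) h hh ⟨fun i hie => ?_, fun i hie => ?_⟩
    · rcases Nat.lt_or_ge i s with h4 | h4
      · have := hPh.1 i h4; omega
      · rw [hi i h4 (by omega)]; omega
    · rcases Nat.lt_or_ge i s with h4 | h4
      · exact hPh.2 i h4
      · rw [hi i h4 (by omega), hi e hse le_rfl]

end ModularLaw

/-! ### The modular law for Hessenberg varieties -/

section Hessenberg

open Module

variable {F E : Type*} [Field F] [AddCommGroup E] [Module F E] [Finite E]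

/-- The subspaces of `U` that contain `L` as a subspace of codimension one. -/
noncomputable def coversBetween (L U : Submodule F E) : Finset (Submodule F E) :=
  (Set.toFinite {W | L ≤ W ∧ W ≤ U ∧ finrank F W = finrank F L + 1}).toFinset

theorem mem_coversBetween {L U W : Submodule F E} :
    W ∈ coversBetween L U ↔ L ≤ W ∧ W ≤ U ∧ finrank F W = finrank F L + 1 := by
  simp [coversBetween]

theorem Submodule.ncard_sdiff_eq {L U : Submodule F E} (hLU : L ≤ U) :
    ((U : Set E) \ L).ncard = Nat.card F ^ finrank F U - Nat.card F ^ finrank F L := by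
  rw [Set.ncard_sdiff (by exact_mod_cast hLU)]
  congr 1 <;> exact natCard_eq_pow_finrank

/-- Each vector of `U` outside `L` lies in just one of these subspaces. -/
theorem card_coversBetween_mul [Finite F] {L U : Submodule F E} (hLU : L ≤ U) :
    (coversBetween L U).card * (Nat.card F ^ (finrank F L + 1) - Nat.card F ^ finrank F L) =
      Nat.card F ^ finrank F U - Nat.card F ^ finrank F L := by
  classical
  set S : Finset E := (Set.toFinite ((U : Set E) \ L)).toFinset with hS
  have hmem : ∀ v, v ∈ S ↔ v ∈ U ∧ v ∉ L := by simp [hS]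
  have hmaps : ∀ v ∈ S, L ⊔ Submodule.span F {v} ∈ coversBetween L U := by
    intro v hv
    rw [hmem] at hv
    rw [mem_coversBetween]
    refine ⟨le_sup_left, sup_le hLU (by simpa using hv.1), ?_⟩
    exact Submodule.finrank_sup_span_singleton hv.2
  have h1 := Finset.card_eq_sum_card_fiberwise hmaps
  rw [← Submodule.ncard_sdiff_eq hLU, Set.ncard_eq_toFinset_card _ (Set.toFinite _), ← hS, h1,
    Finset.sum_const_nat]
  intro W hW
  rw [mem_coversBetween] at hW
  rw [← hW.2.2, ← Submodule.ncard_sdiff_eq hW.1, Set.ncard_eq_toFinset_card _ (Set.toFinite _)]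
  congr 1
  ext v
  simp only [Finset.mem_filter, hmem, Set.Finite.mem_toFinset, Set.mem_sdiff, SetLike.mem_coe]
  constructor
  · rintro ⟨⟨_, h3⟩, rfl⟩
    exact ⟨Submodule.mem_sup_right (Submodule.mem_span_singleton_self v), h3⟩
  · rintro ⟨h2, h3⟩
    refine ⟨⟨hW.2.1 h2, h3⟩, Submodule.eq_of_le_of_finrank_le ?_ ?_⟩
    · exact sup_le hW.1 (by simpa using h2)
    · rw [hW.2.2, Submodule.finrank_sup_span_singleton h3]

theorem card_coversBetween [Finite F] {L U : Submodule F E} (hLU : L ≤ U) :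
    ((coversBetween L U).card : ℤ) =
      ∑ i ∈ Finset.range (finrank F U - finrank F L), (Nat.card F : ℤ) ^ i := by
  have hq : 1 < Nat.card F := Finite.one_lt_card
  have h := card_coversBetween_mul hLU
  obtain ⟨k, hk⟩ := Nat.exists_eq_add_of_le (Submodule.finrank_mono hLU)
  rw [hk] at h ⊢
  zify [Nat.pow_le_pow_right hq.le (Nat.le_succ (finrank F L)),
    Nat.pow_le_pow_right hq.le (Nat.le_add_right (finrank F L) k)] at h
  have hq' : (1 : ℤ) < Nat.card F := by exact_mod_cast hq
  have hg := geom_sum_mul (Nat.card F : ℤ) k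
  have hne : (Nat.card F : ℤ) ^ finrank F L * ((Nat.card F : ℤ) - 1) ≠ 0 :=
    mul_ne_zero (by positivity) (by omega)
  rw [Nat.add_sub_cancel_left]
  apply mul_right_cancel₀ hne
  rw [pow_succ, pow_add] at h
  linear_combination h - (Nat.card F : ℤ) ^ finrank F L * hg

/-- The counting behind the modular law, with `c₀` and `c₂` the conditions of the two outer
varieties and `p` that of the middle one, for the subspace `W` that is left free. -/
theorem sum_coversBetween_eq_zero [Finite F] {L U : Submodule F E} (hLU : L ≤ U)
    (hfin : finrank F U = finrank F L + 2) (p : Submodule F E → Prop) (c₀ c₂ : Prop)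
    [DecidablePred p] [Decidable c₀] [Decidable c₂] (h02 : c₀ → c₂)
    (h0 : c₀ → ∀ W ∈ coversBetween L U, p W) (h2 : ∀ W ∈ coversBetween L U, p W → c₂)
    (h1 : c₂ → ¬ c₀ → ∃ W₀ ∈ coversBetween L U, ∀ W ∈ coversBetween L U, p W ↔ W = W₀) :
    ∑ W ∈ coversBetween L U, ((1 + (Nat.card F : ℤ)) * (if p W then 1 else 0) -
      Nat.card F * (if c₀ then 1 else 0) - (if c₂ then 1 else 0)) = 0 := by
  classical
  have hcard : ((coversBetween L U).card : ℤ) = 1 + Nat.card F := by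
    rw [card_coversBetween hLU, hfin, Nat.add_sub_cancel_left]
    simp [Finset.sum_range_succ]
  by_cases hc0 : c₀
  · rw [Finset.sum_congr rfl fun W hW => by rw [if_pos (h0 hc0 W hW)]]
    simp [hc0, h02 hc0]
  by_cases hc2 : c₂
  · obtain ⟨W₀, hW₀, hW⟩ := h1 hc2 hc0
    rw [Finset.sum_congr rfl fun W hW' => by rw [if_congr (hW W hW') rfl rfl]]
    simp [hc0, hc2, hcard, hW₀]
  · rw [Finset.sum_congr rfl fun W hW => by rw [if_neg fun h => hc2 (h2 W hW h)]]
    simp [hc0, hc2]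

theorem finite_setOf_flags (n : ℕ) :
    {V : ℕ → Submodule F E | Monotone V ∧ ∀ k, finrank F (V k) = min k n}.Finite := by
  refine Set.Finite.of_finite_image (f := fun V (k : Fin (n + 1)) => V k) (Set.toFinite _) ?_
  rintro V ⟨hV, hV'⟩ V' ⟨hW, hW'⟩ h
  funext k
  have hk : ∀ k ≤ n, V k = V' k := fun k hk => congrFun h ⟨k, Nat.lt_succ_of_le hk⟩
  rcases Nat.lt_or_ge n k with h1 | h1
  · rw [← Submodule.eq_of_le_of_finrank_le (hV h1.le) (by rw [hV', hV']; omega),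
      ← Submodule.eq_of_le_of_finrank_le (hW h1.le) (by rw [hW', hW']; omega), hk n le_rfl]
  · exact hk k h1

variable (F E) in
/-- The flags `0 = V 0 ⊆ V 1 ⊆ ⋯ ⊆ V n` with `dim V k = k`, continued by `V k = V n` for
`n ≤ k`. -/
noncomputable def completeFlags (n : ℕ) : Finset (ℕ → Submodule F E) :=
  (finite_setOf_flags (F := F) (E := E) n).toFinset

theorem mem_completeFlags {n : ℕ} {V : ℕ → Submodule F E} :
    V ∈ completeFlags F E n ↔ Monotone V ∧ ∀ k, finrank F (V k) = min k n := by
  simp [completeFlags]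

theorem update_mem_completeFlags {n j : ℕ} (hj : j + 2 ≤ n) {V : ℕ → Submodule F E}
    (hV : V ∈ completeFlags F E n) {W : Submodule F E}
    (hW : W ∈ coversBetween (V j) (V (j + 2))) :
    Function.update V (j + 1) W ∈ completeFlags F E n := by
  rw [mem_completeFlags] at hV ⊢
  rw [mem_coversBetween] at hW
  refine ⟨fun k l hkl => ?_, fun k => ?_⟩
  · rw [Function.update_apply, Function.update_apply]
    split_ifs with h1 h2 h2
    · exact le_rfl
    · exact hW.2.1.trans (hV.1 (by omega))
    · exact (hV.1 (by omega)).trans hW.1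
    · exact hV.1 hkl
  · rcases eq_or_ne k (j + 1) with rfl | h1
    · rw [Function.update_self, hW.2.2, hV.2]; omega
    · rw [Function.update_of_ne h1, hV.2]

/-- A sum over flags vanishes if its partial sums over the flags that differ in one given place
do. -/
theorem sum_completeFlags_eq_zero [Finite F] {n j : ℕ} (hj : j + 2 ≤ n)
    (g : (ℕ → Submodule F E) → ℤ)
    (hg : ∀ V ∈ completeFlags F E n,
      ∑ W ∈ coversBetween (V j) (V (j + 2)), g (Function.update V (j + 1) W) = 0) :
    ∑ V ∈ completeFlags F E n, g V = 0 := by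
  have h1 : ∑ V ∈ completeFlags F E n, ∑ _W ∈ coversBetween (V j) (V (j + 2)), g V =
      ∑ V ∈ completeFlags F E n,
        ∑ W ∈ coversBetween (V j) (V (j + 2)), g (Function.update V (j + 1) W) := by
    -- The pairs `(V, W)` have the involution that exchanges `V (j + 1)` and `W`.
    rw [Finset.sum_sigma', Finset.sum_sigma']
    have hmem : ∀ x ∈ (completeFlags F E n).sigma fun V => coversBetween (V j) (V (j + 2)),
        (⟨Function.update x.1 (j + 1) x.2, x.1 (j + 1)⟩ :
          (_ : ℕ → Submodule F E) × Submodule F E) ∈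
        (completeFlags F E n).sigma fun V => coversBetween (V j) (V (j + 2)) := by
      rintro ⟨V, W⟩ hx
      rw [Finset.mem_sigma] at hx ⊢
      refine ⟨update_mem_completeFlags hj hx.1 hx.2, ?_⟩
      have hV := mem_completeFlags.1 hx.1
      dsimp only
      rw [Function.update_of_ne (by omega), Function.update_of_ne (by omega), mem_coversBetween,
        hV.2, hV.2]
      exact ⟨hV.1 (by omega), hV.1 (by omega), by omega⟩
    refine Finset.sum_bij' (fun x _ => ⟨Function.update x.1 (j + 1) x.2, x.1 (j + 1)⟩)
      (fun x _ => ⟨Function.update x.1 (j + 1) x.2, x.1 (j + 1)⟩) hmem hmem ?_ ?_ ?_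
    · rintro ⟨V, W⟩ _
      simp
    · rintro ⟨V, W⟩ _
      simp
    · rintro ⟨V, W⟩ _
      simp
  rw [Finset.sum_congr rfl hg, Finset.sum_const_zero] at h1
  have h2 : ∀ V ∈ completeFlags F E n, ∑ _W ∈ coversBetween (V j) (V (j + 2)), g V =
      (1 + Nat.card F : ℤ) * g V := by
    intro V hV
    rw [mem_completeFlags] at hV
    rw [Finset.sum_const, nsmul_eq_mul, card_coversBetween (hV.1 (by omega)), hV.2, hV.2,
      show min (j + 2) n - min j n = 2 by omega]
    simp [Finset.sum_range_succ]
  rw [Finset.sum_congr rfl h2, ← Finset.mul_sum] at h1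
  rcases mul_eq_zero.1 h1 with h | h
  · have : (0 : ℤ) ≤ Nat.card F := by positivity
    omega
  · exact h

open Classical in
/-- The flags of the Hessenberg variety of `h` and `T`. -/
noncomputable def hessenbergFlags (n : ℕ) (T : E →ₗ[F] E) (h : ℕ → ℕ) :
    Finset (ℕ → Submodule F E) :=
  {V ∈ completeFlags F E n | ∀ i < n, (V (i + 1)).map T ≤ V (h i + 1)}

theorem finrank_sup_map_le (T : E →ₗ[F] E) {A B L : Submodule F E} (hAB : A ≤ B)
    (hfin : finrank F B = finrank F A + 1) (hA : A.map T ≤ L) :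
    finrank F (L ⊔ B.map T : Submodule F E) ≤ finrank F L + 1 := by
  obtain ⟨v, hvB, hvA⟩ : ∃ v ∈ B, v ∉ A := by
    by_contra! h
    have : B = A := le_antisymm h hAB
    rw [this] at hfin
    omega
  have hB : B = A ⊔ Submodule.span F {v} := by
    refine (Submodule.eq_of_le_of_finrank_le (sup_le hAB (by simpa using hvB)) ?_).symm
    rw [hfin, Submodule.finrank_sup_span_singleton hvA]
  rw [hB, Submodule.map_sup, ← sup_assoc, sup_eq_left.2 hA, Submodule.map_span,
    Set.image_singleton]
  by_cases h : T v ∈ L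
  · rw [sup_eq_left.2 (by simpa using h)]
    exact Nat.le_succ _
  · rw [Submodule.finrank_sup_span_singleton h]

theorem finrank_le_inf_comap (T : E →ₗ[F] E) {A A' U : Submodule F E}
    (hfin : finrank F A' = finrank F A + 1) (hAA : A ≤ A') (hU : U.map T ≤ A') :
    finrank F U ≤ finrank F (U ⊓ A.comap T : Submodule F E) + 1 := by
  set φ : U →ₗ[F] E ⧸ A := (A.mkQ.comp T).domRestrict U with hφ
  have h1 := LinearMap.finrank_range_add_finrank_ker φ
  have h2 : finrank F (LinearMap.range φ) ≤ 1 := by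
    have h3 : LinearMap.range φ ≤ A'.map A.mkQ := by
      rintro _ ⟨u, rfl⟩
      exact ⟨T u, hU ⟨u, u.2, rfl⟩, rfl⟩
    refine (Submodule.finrank_mono h3).trans ?_
    have h4 := LinearMap.finrank_range_add_finrank_ker (A.mkQ.domRestrict A')
    have h5 : LinearMap.range (A.mkQ.domRestrict A') = A'.map A.mkQ := by
      rw [LinearMap.range_domRestrict]
    have h6 : finrank F (LinearMap.ker (A.mkQ.domRestrict A')) = finrank F A := by
      rw [LinearMap.ker_domRestrict, Submodule.ker_mkQ]
      exact (Submodule.comapSubtypeEquivOfLe hAA).finrank_eq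
    rw [h5, h6] at h4
    omega
  have h7 : finrank F (LinearMap.ker φ) = finrank F (U ⊓ A.comap T : Submodule F E) := by
    have : LinearMap.ker φ = (U ⊓ A.comap T).comap U.subtype := by
      ext u
      simp [hφ]
    rw [this]
    exact (Submodule.comapSubtypeEquivOfLe inf_le_left).finrank_eq
  omega

/-- The number of points of Hessenberg varieties has the modular law. In each of the two cases
one member of the flag is left free between its neighbours `L ⊆ U`: the member containing the
image of the `i`-th one, or the `i`-th member itself. -/
theorem modularLaw_card_hessenbergFlags [Finite F] (n : ℕ) (T : E →ₗ[F] E) :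
    ModularLaw n (Nat.card F) fun h => ((hessenbergFlags n T h).card : ℤ) := by
  classical
  refine ⟨fun h i a hi H0 H2 hrow => ?_, fun h i a hi H0 h1 h2 hne H2 => ?_⟩
  · have hia : i ≤ a := by simpa using H0.le_apply i hi
    have han : a + 2 < n := by simpa using H2.apply_lt i hi
    have hlow : ∀ r < i, h r ≤ a := fun r hr => by
      have := H0.mono r i hr.le hi
      rwa [Function.update_self, Function.update_of_ne hr.ne] at this
    have hhigh : ∀ r, i < r → r < n → a + 2 ≤ h r := fun r hr hrn => by
      have := H2.mono i r hr.le hrn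
      rwa [Function.update_self, Function.update_of_ne hr.ne'] at this
    suffices key : ∑ V ∈ completeFlags F E n, ((1 + (Nat.card F : ℤ)) *
        (if ∀ r < n, (V (r + 1)).map T ≤ V (Function.update h i (a + 1) r + 1) then 1 else 0) -
        Nat.card F *
          (if ∀ r < n, (V (r + 1)).map T ≤ V (Function.update h i a r + 1) then 1 else 0) -
        (if ∀ r < n, (V (r + 1)).map T ≤ V (Function.update h i (a + 2) r + 1)
          then 1 else 0)) = 0 by
      rw [Finset.sum_sub_distrib, Finset.sum_sub_distrib, ← Finset.mul_sum, ← Finset.mul_sum] at key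
      simp only [hessenbergFlags, Finset.card_filter, Nat.cast_sum, Nat.cast_ite, Nat.cast_one,
        Nat.cast_zero]
      linear_combination key
    refine sum_completeFlags_eq_zero (j := a + 1) (by omega) _ fun V hV => ?_
    have hV' := mem_completeFlags.1 hV
    have hLU : V (a + 1) ≤ V (a + 1 + 2) := hV'.1 (by omega)
    -- The free member is `V (a + 2)`. The condition on it from row `a + 1` follows from that of
    -- row `a + 2`, which has the same end; so besides `C` only the condition of row `i` is left.
    set C : Prop := ∀ r < n, r ≠ i → r ≠ a + 1 → (V (r + 1)).map T ≤ V (h r + 1) with hC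
    have hiff : ∀ b ≤ 2, ∀ W ∈ coversBetween (V (a + 1)) (V (a + 1 + 2)),
        (∀ r < n, (Function.update V (a + 1 + 1) W (r + 1)).map T ≤
          Function.update V (a + 1 + 1) W (Function.update h i (a + b) r + 1)) ↔
        C ∧ (V (i + 1)).map T ≤ Function.update V (a + 1 + 1) W (a + b + 1) := by
      intro b hb W hW
      rw [mem_coversBetween] at hW
      constructor
      · intro hall
        refine ⟨fun r hr hri hra => ?_, ?_⟩
        · have := hall r hr
          rw [Function.update_of_ne (by omega), Function.update_of_ne hri,
            Function.update_of_ne] at this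
          · exact this
          · rcases Nat.lt_or_ge r i with h3 | h3
            · have := hlow r h3; omega
            · have := hhigh r (by omega) hr; omega
        · have := hall i hi
          rwa [Function.update_self, Function.update_of_ne (by omega)] at this
      · rintro ⟨hCall, hXb⟩ r hr
        by_cases hri : r = i
        · subst hri
          rwa [Function.update_self, Function.update_of_ne (by omega)]
        · have hne : h r + 1 ≠ a + 1 + 1 := by
            rcases Nat.lt_or_ge r i with h3 | h3
            · have := hlow r h3; omega
            · have := hhigh r (by omega) hr; omega
          rw [Function.update_of_ne hri, Function.update_of_ne hne]
          by_cases hra : r = a + 1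
          · subst hra
            rw [Function.update_self, hrow]
            exact (Submodule.map_mono hW.2.1).trans (hCall (a + 2) (by omega) (by omega) (by omega))
          · rw [Function.update_of_ne (by omega)]
            exact hCall r hr hri hra
    have hiff1 := hiff 1 (by omega)
    have hiff0 := hiff 0 (by omega)
    simp only [Nat.add_zero] at hiff0
    have hiff2 := hiff 2 (by omega)
    rw [Finset.sum_congr rfl fun W hW => by rw [if_congr (hiff1 W hW) rfl rfl,
      if_congr (hiff0 W hW) rfl rfl, if_congr (hiff2 W hW) rfl rfl, Function.update_self,
      Function.update_of_ne (by omega), Function.update_of_ne (by omega)]]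
    by_cases hCt : C
    · simp only [hCt, true_and]
      have hX : (V i).map T ≤ V (a + 1) := by
        rcases Nat.eq_zero_or_pos i with h0 | h0
        · have : V i = ⊥ := Submodule.finrank_eq_zero.1 (by rw [hV'.2, h0]; simp)
          rw [this, Submodule.map_bot]
          exact bot_le
        · have := hCt (i - 1) (by omega) (by omega) (by omega)
          rw [Nat.sub_add_cancel h0] at this
          exact this.trans (hV'.1 (by have := hlow (i - 1) (by omega); omega))
      have hXfin := finrank_sup_map_le T (hV'.1 (show i ≤ i + 1 by omega))
        (by rw [hV'.2, hV'.2]; omega) hX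
      refine sum_coversBetween_eq_zero hLU (by rw [hV'.2, hV'.2]; omega) _ _ _
        (fun h0 => h0.trans hLU) (fun h0 W hW => h0.trans (mem_coversBetween.1 hW).1)
        (fun W hW hp => hp.trans (mem_coversBetween.1 hW).2.1) fun hc2 hc0 => ?_
      -- The only admissible `W` is `V (a + 1) ⊔ T (V (i + 1))`.
      have hlt : V (a + 1) < V (a + 1) ⊔ (V (i + 1)).map T :=
        lt_of_le_of_ne le_sup_left fun h => hc0 (by rw [h]; exact le_sup_right)
      have hlt' := Submodule.finrank_lt_finrank_of_lt hlt
      refine ⟨V (a + 1) ⊔ (V (i + 1)).map T, mem_coversBetween.2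
        ⟨le_sup_left, sup_le hLU hc2, by omega⟩, fun W hW => ⟨fun hp => ?_, ?_⟩⟩
      · have hW' := mem_coversBetween.1 hW
        exact (Submodule.eq_of_le_of_finrank_le (sup_le hW'.1 hp) (by omega)).symm
      · rintro rfl
        exact le_sup_right
    · simp [hCt]
  · have hai : i < a := h2 ▸ H0.le_apply (i + 1) hi
    have han : a + 1 < n := by simpa using H2.apply_lt i (by omega)
    suffices key : ∑ V ∈ completeFlags F E n, ((1 + (Nat.card F : ℤ)) *
        (if ∀ r < n, (V (r + 1)).map T ≤ V (Function.update h (i + 1) (a + 1) r + 1)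
          then 1 else 0) -
        Nat.card F * (if ∀ r < n, (V (r + 1)).map T ≤ V (h r + 1) then 1 else 0) -
        (if ∀ r < n, (V (r + 1)).map T ≤
          V (Function.update (Function.update h (i + 1) (a + 1)) i (a + 1) r + 1)
          then 1 else 0)) = 0 by
      rw [Finset.sum_sub_distrib, Finset.sum_sub_distrib, ← Finset.mul_sum, ← Finset.mul_sum] at key
      simp only [hessenbergFlags, Finset.card_filter, Nat.cast_sum, Nat.cast_ite, Nat.cast_one,
        Nat.cast_zero]
      linear_combination key
    refine sum_completeFlags_eq_zero (j := i) (by omega) _ fun V hV => ?_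
    have hV' := mem_completeFlags.1 hV
    have hLU : V i ≤ V (i + 2) := hV'.1 (by omega)
    have hAA : V (a + 1) ≤ V (a + 2) := hV'.1 (by omega)
    -- The free member is `V (i + 1)`. As no row ends at `i`, only the condition of row `i`
    -- involves it.
    set C : Prop := ∀ r < n, r ≠ i → r ≠ i + 1 → (V (r + 1)).map T ≤ V (h r + 1) with hC
    have hiff : ∀ h' : ℕ → ℕ, (∀ r, r ≠ i → r ≠ i + 1 → h' r = h r) → i < h' i → i < h' (i + 1) →
        ∀ W ∈ coversBetween (V i) (V (i + 2)),
        ((∀ r < n, (Function.update V (i + 1) W (r + 1)).map T ≤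
          Function.update V (i + 1) W (h' r + 1)) ↔
        C ∧ W.map T ≤ V (h' i + 1) ∧ (V (i + 2)).map T ≤ V (h' (i + 1) + 1)) := by
      intro h' hag hi1 hi2 W hW
      constructor
      · intro hall
        refine ⟨fun r hr hri hra => ?_, ?_, ?_⟩
        · have := hall r hr
          have h3 := hne r hr
          rwa [Function.update_of_ne (by omega), hag r hri hra,
            Function.update_of_ne (by omega)] at this
        · have := hall i (by omega)
          rwa [Function.update_self, Function.update_of_ne (by omega)] at this
        · have := hall (i + 1) hi
          rwa [Function.update_of_ne (by omega), Function.update_of_ne (by omega)] at this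
      · rintro ⟨hCall, hX1, hX2⟩ r hr
        by_cases hri : r = i
        · subst hri
          rwa [Function.update_self, Function.update_of_ne (by omega)]
        by_cases hri' : r = i + 1
        · subst hri'
          rwa [Function.update_of_ne (by omega), Function.update_of_ne (by omega)]
        have h3 := hne r hr
        rw [Function.update_of_ne (by omega), hag r hri hri', Function.update_of_ne (by omega)]
        exact hCall r hr hri hri'
    have hiff1 := hiff (Function.update h (i + 1) (a + 1))
      (fun r _ h4 => Function.update_of_ne h4 _ _)
      (by rw [Function.update_of_ne (by omega)]; omega) (by rw [Function.update_self]; omega)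
    have hiff0 := hiff h (fun r _ _ => rfl) (by omega) (by omega)
    have hiff2 := hiff (Function.update (Function.update h (i + 1) (a + 1)) i (a + 1))
      (fun r h3 h4 => by rw [Function.update_of_ne h3, Function.update_of_ne h4])
      (by rw [Function.update_self]; omega)
      (by rw [Function.update_of_ne (by omega), Function.update_self]; omega)
    rw [Function.update_self, Function.update_of_ne (by omega), h1] at hiff1
    rw [h1, h2] at hiff0
    rw [Function.update_self, Function.update_of_ne (by omega), Function.update_self] at hiff2
    have hmap : ∀ W ∈ coversBetween (V i) (V (i + 2)), W.map T ≤ (V (i + 2)).map T :=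
      fun W hW => Submodule.map_mono (mem_coversBetween.1 hW).2.1
    have hiff0' : ∀ W ∈ coversBetween (V i) (V (i + 2)),
        (C ∧ W.map T ≤ V (a + 1) ∧ (V (i + 2)).map T ≤ V (a + 1) ↔
          C ∧ (V (i + 2)).map T ≤ V (a + 1)) := fun W hW =>
      and_congr_right fun _ => and_iff_right_of_imp (hmap W hW).trans
    have hiff2' : ∀ W ∈ coversBetween (V i) (V (i + 2)),
        (C ∧ W.map T ≤ V (a + 1 + 1) ∧ (V (i + 2)).map T ≤ V (a + 1 + 1) ↔
          C ∧ (V (i + 2)).map T ≤ V (a + 2)) := fun W hW =>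
      and_congr_right fun _ => and_iff_right_of_imp (hmap W hW).trans
    rw [Finset.sum_congr rfl fun W hW => by rw [if_congr (hiff1 W hW) rfl rfl,
      if_congr ((hiff0 W hW).trans (hiff0' W hW)) rfl rfl,
      if_congr ((hiff2 W hW).trans (hiff2' W hW)) rfl rfl]]
    by_cases hCt : C
    · simp only [hCt, true_and]
      have hX : (V i).map T ≤ V (a + 1) := by
        rcases Nat.eq_zero_or_pos i with h0 | h0
        · have : V i = ⊥ := Submodule.finrank_eq_zero.1 (by rw [hV'.2, h0]; simp)
          rw [this, Submodule.map_bot]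
          exact bot_le
        · have := hCt (i - 1) (by omega) (by omega) (by omega)
          rw [Nat.sub_add_cancel h0] at this
          refine this.trans (hV'.1 ?_)
          have := H0.mono (i - 1) i (by omega) (by omega)
          omega
      refine sum_coversBetween_eq_zero hLU (by rw [hV'.2, hV'.2]; omega) _ _ _
        (fun h0 => h0.trans hAA) (fun h0 W hW => ⟨(hmap W hW).trans h0, h0.trans hAA⟩)
        (fun W hW hp => hp.2) fun hc2 hc0 => ?_
      -- The only admissible `W` is the part of `V (i + 2)` that `T` takes into `V (a + 1)`.
      set K := V (i + 2) ⊓ (V (a + 1)).comap T with hK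
      have hKfin := finrank_le_inf_comap T (by rw [hV'.2, hV'.2]; omega) hAA hc2
      have hLK : V i ≤ K := le_inf hLU (Submodule.map_le_iff_le_comap.1 hX)
      have hlt : K < V (i + 2) := lt_of_le_of_ne inf_le_left fun h =>
        hc0 (Submodule.map_le_iff_le_comap.2 (by rw [← h]; exact inf_le_right))
      have hlt' := Submodule.finrank_lt_finrank_of_lt hlt
      have hfin2 : finrank F (V (i + 2)) = finrank F (V i) + 2 := by
        rw [hV'.2, hV'.2]; omega
      have hKm : K ∈ coversBetween (V i) (V (i + 2)) :=
        mem_coversBetween.2 ⟨hLK, inf_le_left, by rw [← hK] at hKfin; omega⟩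
      have hKfin' := (mem_coversBetween.1 hKm).2.2
      refine ⟨K, hKm, fun W hW => ⟨fun hp => ?_, ?_⟩⟩
      · have hW' := mem_coversBetween.1 hW
        refine Submodule.eq_of_le_of_finrank_le
          (le_inf hW'.2.1 (Submodule.map_le_iff_le_comap.1 hp.1)) ?_
        rw [hW'.2.2]
        exact hKfin'.le
      · rintro rfl
        exact ⟨Submodule.map_le_iff_le_comap.2 inf_le_right, hc2⟩
    · simp [hCt]

end Hessenberg

/-! ### The modular law for chromatic quasisymmetric functions -/

section Chromatic

/-- The weight of an edge whose lower and upper ends have the colors `x` and `y`. -/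
def edgeWeight (t : ℤ) (x y : ℕ) : ℤ := if x = y then 0 else if x < y then t else 1

/-- The product of the weights of the edges `{i, j}`, `i < j ≤ h i`: it is `t ^ asc κ` for a
proper coloring `κ`, and zero otherwise. -/
def coloringWeight (t : ℤ) (n : ℕ) (h : ℕ → ℕ) (κ : Fin n → ℕ) : ℤ :=
  ∏ i : Fin n, ∏ j : Fin n,
    if i < j ∧ (j : ℕ) ≤ h i then edgeWeight t (κ i) (κ j) else 1

/-- The maps `Fin n → ℕ` that take the value `c` exactly `d c` times. -/
noncomputable def coloringsOfContent (n : ℕ) (d : ℕ →₀ ℕ) : Finset (Fin n → ℕ) :=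
  {κ ∈ Fintype.piFinset fun _ => d.support | ∑ v, Finsupp.single (κ v) 1 = d}

theorem mem_coloringsOfContent {n : ℕ} {d : ℕ →₀ ℕ} {κ : Fin n → ℕ} :
    κ ∈ coloringsOfContent n d ↔ ∑ v, Finsupp.single (κ v) 1 = d := by
  rw [coloringsOfContent, Finset.mem_filter, and_iff_right_iff_imp]
  rintro rfl
  rw [Fintype.mem_piFinset]
  intro v
  rw [Finsupp.mem_support_iff, Finsupp.finsetSum_apply]
  refine (lt_of_lt_of_le zero_lt_one ?_).ne'
  refine le_trans ?_ (Finset.single_le_sum (f := fun w => Finsupp.single (κ w) 1 (κ v))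
    (fun _ _ => Nat.zero_le _) (Finset.mem_univ v))
  simp

/-- The chromatic quasisymmetric function of the indifference graph of `h`. -/
noncomputable def chromaticSeries (t : ℤ) (n : ℕ) (h : ℕ → ℕ) : MvPowerSeries ℕ ℤ :=
  fun d => ∑ κ ∈ coloringsOfContent n d, coloringWeight t n h κ

theorem coeff_chromaticSeries (t : ℤ) (n : ℕ) (h : ℕ → ℕ) (d : ℕ →₀ ℕ) :
    MvPowerSeries.coeff d (chromaticSeries t n h) =
      ∑ κ ∈ coloringsOfContent n d, coloringWeight t n h κ := rfl

/-- Adding the edge `{r, b + 1}` to the graph. -/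
theorem coloringWeight_update (t : ℤ) {n : ℕ} (h : ℕ → ℕ) {r b : ℕ} (hr : r < n) (hb : b + 1 < n)
    (hrb : r ≤ b) (hh : h r = b) (κ : Fin n → ℕ) :
    coloringWeight t n (Function.update h r (b + 1)) κ =
      coloringWeight t n h κ * edgeWeight t (κ ⟨r, hr⟩) (κ ⟨b + 1, hb⟩) := by
  have h1 : ∀ i j : Fin n, (if i < j ∧ (j : ℕ) ≤ Function.update h r (b + 1) i then
      edgeWeight t (κ i) (κ j) else 1) =
      (if i < j ∧ (j : ℕ) ≤ h i then edgeWeight t (κ i) (κ j) else 1) *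
      (if i = ⟨r, hr⟩ then if j = ⟨b + 1, hb⟩ then edgeWeight t (κ i) (κ j) else 1 else 1) := by
    intro i j
    by_cases hi : i = ⟨r, hr⟩
    · subst hi
      rw [Function.update_self, if_pos rfl]
      by_cases hj : j = ⟨b + 1, hb⟩
      · subst hj
        rw [if_pos ⟨by rw [Fin.lt_def]; dsimp only; omega, le_rfl⟩, if_neg, if_pos rfl, one_mul]
        dsimp only; omega
      · rw [if_neg hj, mul_one]
        refine if_congr (and_congr_right fun _ => ?_) rfl rfl
        rw [Fin.ext_iff] at hj
        dsimp only at hj ⊢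
        omega
    · rw [if_neg hi, mul_one, Function.update_of_ne fun h => hi (Fin.ext h)]
  simp only [coloringWeight, h1, Finset.prod_mul_distrib]
  congr 1
  rw [Finset.prod_eq_single ⟨r, hr⟩, Finset.prod_eq_single ⟨b + 1, hb⟩]
  · simp
  · intro j _ hj
    simp [hj]
  · simp
  · intro i _ hi
    simp [hi]
  · simp

/-- If `u` and `u + 1` are adjacent and have the same neighbours, exchanging their colors changes
only the weight of the edge between them. -/
theorem exists_coloringWeight_swap (t : ℤ) {n : ℕ} {h : ℕ → ℕ} {u : ℕ} (hu : u + 1 < n)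
    (hadj : u + 1 ≤ h u) (hup : h u = h (u + 1)) (hlow : ∀ j < u, h j ≠ u) (κ : Fin n → ℕ) :
    ∃ w : ℤ, coloringWeight t n h κ = w * edgeWeight t (κ ⟨u, by omega⟩) (κ ⟨u + 1, hu⟩) ∧
      coloringWeight t n h (κ ∘ Equiv.swap (⟨u, by omega⟩ : Fin n) ⟨u + 1, hu⟩) =
        w * edgeWeight t (κ ⟨u + 1, hu⟩) (κ ⟨u, by omega⟩) := by
  set a : Fin n := ⟨u, by omega⟩ with ha
  set b : Fin n := ⟨u + 1, hu⟩ with hb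
  have hab : a ≠ b := by simp [ha, hb]
  set σ := Equiv.swap a b with hσ
  let w : (Fin n → ℕ) → ℤ := fun κ => ∏ i : Fin n, ∏ j : Fin n,
    if i < j ∧ (j : ℕ) ≤ h i ∧ ¬ (i = a ∧ j = b) then edgeWeight t (κ i) (κ j) else 1
  have hw : ∀ κ, coloringWeight t n h κ = w κ * edgeWeight t (κ a) (κ b) := by
    intro κ
    have h1 : ∀ i j : Fin n, (if i < j ∧ (j : ℕ) ≤ h i then edgeWeight t (κ i) (κ j) else 1) =
        (if i < j ∧ (j : ℕ) ≤ h i ∧ ¬ (i = a ∧ j = b) then edgeWeight t (κ i) (κ j) else 1) *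
        (if i = a then if j = b then edgeWeight t (κ i) (κ j) else 1 else 1) := by
      intro i j
      by_cases hi : i = a <;> by_cases hj : j = b
      · subst hi hj
        rw [if_pos ⟨by simp [ha, hb, Fin.lt_def], hadj⟩]
        simp
      · simp [hi, hj]
      · simp [hi]
      · simp [hi]
    simp only [coloringWeight, h1, Finset.prod_mul_distrib, w]
    congr 1
    rw [Finset.prod_eq_single a, Finset.prod_eq_single b]
    · simp
    · intro j _ hj
      simp [hj]
    · simp
    · intro i _ hi
      simp [hi]
    · simp
  have hcases : ∀ i : Fin n, (i = a ∧ (σ i : ℕ) = u + 1 ∧ (i : ℕ) = u) ∨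
      (i = b ∧ (σ i : ℕ) = u ∧ (i : ℕ) = u + 1) ∨
      (i ≠ a ∧ i ≠ b ∧ (σ i : ℕ) = i ∧ (i : ℕ) ≠ u ∧ (i : ℕ) ≠ u + 1) := by
    intro i
    by_cases hi : i = a
    · left
      rw [hi, hσ, Equiv.swap_apply_left]
      exact ⟨rfl, rfl, rfl⟩
    · by_cases hi' : i = b
      · right; left
        rw [hi', hσ, Equiv.swap_apply_right]
        exact ⟨rfl, rfl, rfl⟩
      · right; right
        rw [hσ, Equiv.swap_apply_of_ne_of_ne hi hi']
        exact ⟨hi, hi', rfl, fun h => hi (Fin.ext h), fun h => hi' (Fin.ext h)⟩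
  have hiff : ∀ i j : Fin n, (σ i < σ j ∧ (σ j : ℕ) ≤ h (σ i) ∧ ¬ (σ i = a ∧ σ j = b)) ↔
      (i < j ∧ (j : ℕ) ≤ h i ∧ ¬ (i = a ∧ j = b)) := by
    intro i j
    simp only [Fin.lt_def, Fin.ext_iff]
    have hav : (a : ℕ) = u := rfl
    have hbv : (b : ℕ) = u + 1 := rfl
    rw [hav, hbv]
    rcases hcases i with ⟨_, h1, h2⟩ | ⟨_, h1, h2⟩ | ⟨_, _, h1, h2⟩ <;>
    rcases hcases j with ⟨_, h3, h4⟩ | ⟨_, h3, h4⟩ | ⟨_, _, h3, h4⟩ <;> rw [h1, h3]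
    · omega
    · omega
    · rw [h2]; omega
    · omega
    · omega
    · rw [h2]; omega
    · rw [h4]
      have := hlow i
      omega
    · rw [h4]
      have := hlow i
      omega
  have hwσ : w (κ ∘ σ) = w κ := by
    simp only [w]
    rw [← Equiv.prod_comp σ fun i => ∏ j : Fin n,
      if i < j ∧ (j : ℕ) ≤ h i ∧ ¬ (i = a ∧ j = b) then edgeWeight t (κ i) (κ j) else 1]
    refine Finset.prod_congr rfl fun i _ => ?_
    rw [← Equiv.prod_comp σ fun j =>
      if σ i < j ∧ (j : ℕ) ≤ h (σ i) ∧ ¬ (σ i = a ∧ j = b)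
        then edgeWeight t (κ (σ i)) (κ j) else 1]
    exact Finset.prod_congr rfl fun j _ => (if_congr (hiff i j) rfl rfl).symm
  refine ⟨w κ, hw κ, ?_⟩
  rw [hw, hwσ]
  simp [hσ]

/-- A sum over colorings vanishes if it is antisymmetric under exchanging the colors of two
vertices. -/
theorem sum_coloringsOfContent_eq_zero {n : ℕ} (d : ℕ →₀ ℕ) (σ : Equiv.Perm (Fin n))
    (g : (Fin n → ℕ) → ℤ) (hg : ∀ κ, g κ + g (κ ∘ σ) = 0) :
    ∑ κ ∈ coloringsOfContent n d, g κ = 0 := by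
  have h1 : ∑ κ ∈ coloringsOfContent n d, g κ = ∑ κ ∈ coloringsOfContent n d, g (κ ∘ σ) := by
    have hmem : ∀ (τ : Equiv.Perm (Fin n)), ∀ κ ∈ coloringsOfContent n d,
        κ ∘ τ ∈ coloringsOfContent n d := by
      intro τ κ hκ
      rw [mem_coloringsOfContent] at hκ ⊢
      rw [← hκ]
      exact Equiv.sum_comp τ fun v => Finsupp.single (κ v) 1
    refine Finset.sum_bij' (fun κ _ => κ ∘ σ.symm) (fun κ _ => κ ∘ σ) (hmem _) (hmem _) ?_ ?_ ?_
    · intro κ _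
      funext i; simp
    · intro κ _
      funext i; simp
    · intro κ _
      congr 1
      funext i; simp
  have h2 : ∑ κ ∈ coloringsOfContent n d, g κ + ∑ κ ∈ coloringsOfContent n d, g (κ ∘ σ) = 0 := by
    rw [← Finset.sum_add_distrib]
    exact Finset.sum_eq_zero fun κ _ => hg κ
  omega

theorem edgeWeight_identity_above (t : ℤ) (x y z : ℕ) :
    edgeWeight t x y * ((1 + t) * edgeWeight t y z - t - edgeWeight t y z * edgeWeight t x z) +
      edgeWeight t y x * ((1 + t) * edgeWeight t x z - t -
        edgeWeight t x z * edgeWeight t y z) = 0 := by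
  unfold edgeWeight
  split_ifs <;> first | omega | ring

theorem edgeWeight_identity_below (t : ℤ) (x y z : ℕ) :
    edgeWeight t x y * ((1 + t) * edgeWeight t z x - t - edgeWeight t z x * edgeWeight t z y) +
      edgeWeight t y x * ((1 + t) * edgeWeight t z y - t -
        edgeWeight t z y * edgeWeight t z x) = 0 := by
  unfold edgeWeight
  split_ifs <;> first | omega | ring

/-- The coefficients of the chromatic quasisymmetric functions have the modular law. -/
theorem modularLaw_coeff_chromaticSeries (t : ℤ) (n : ℕ) (d : ℕ →₀ ℕ) :
    ModularLaw n t fun h => MvPowerSeries.coeff d (chromaticSeries t n h) := by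
  refine ⟨fun h i a hi H0 H2 hrow => ?_, fun h i a hi H0 h1 h2 hne H2 => ?_⟩
  · have hia : i ≤ a := by simpa using H0.le_apply i hi
    have han : a + 2 < n := by simpa using H2.apply_lt i hi
    set h0 := Function.update h i a with hh0
    -- The other two graphs arise from that of `h0` by adding the edges `{i, a + 1}` and
    -- `{i, a + 2}`, and in `h0` the vertices `a + 1` and `a + 2` can be exchanged.
    have e1 : Function.update h i (a + 1) = Function.update h0 i (a + 1) := by
      rw [hh0, Function.update_idem]
    have e2 : Function.update h i (a + 2) =
        Function.update (Function.update h0 i (a + 1)) i (a + 1 + 1) := by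
      rw [hh0, Function.update_idem, Function.update_idem]
    have w1 := coloringWeight_update t h0 hi (b := a) (by omega) hia (by simp [hh0])
    have w2 := coloringWeight_update t (Function.update h0 i (a + 1)) hi (b := a + 1) (by omega)
      (by omega) (by simp)
    have hlow : ∀ j < a + 1, h0 j ≠ a + 1 := by
      intro j hj
      rcases lt_trichotomy j i with h3 | h3 | h3
      · have := H0.mono j i h3.le hi
        have h0i : h0 i = a := Function.update_self ..
        omega
      · rw [h3, hh0, Function.update_self]; omega
      · have := H2.mono i j h3.le (by omega)
        rw [Function.update_self, Function.update_of_ne h3.ne'] at this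
        rw [hh0, Function.update_of_ne h3.ne']
        omega
    have hadj : a + 1 + 1 ≤ h0 (a + 1) := by
      have := H0.le_apply (a + 2) (by omega)
      rw [hh0, Function.update_of_ne (by omega)] at this
      rw [hh0, Function.update_of_ne (by omega), hrow]
      exact this
    have hup : h0 (a + 1) = h0 (a + 1 + 1) := by
      rw [hh0, Function.update_of_ne (by omega), Function.update_of_ne (by omega), hrow]
    rw [e2, e1]
    simp only [coeff_chromaticSeries]
    rw [← sub_eq_zero, Finset.mul_sum, Finset.mul_sum, ← Finset.sum_add_distrib,
      ← Finset.sum_sub_distrib]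
    refine sum_coloringsOfContent_eq_zero d
      (Equiv.swap (⟨a + 1, by omega⟩ : Fin n) ⟨a + 1 + 1, by omega⟩) _ fun κ => ?_
    obtain ⟨w, hw, hw'⟩ := exists_coloringWeight_swap t (u := a + 1) (by omega) hadj hup hlow κ
    rw [w2, w1, w2, w1, hw, hw']
    have hne : (⟨i, hi⟩ : Fin n) ≠ ⟨a + 1, by omega⟩ := by simp; omega
    have hne' : (⟨i, hi⟩ : Fin n) ≠ ⟨a + 1 + 1, by omega⟩ := by simp; omega
    simp only [Function.comp, Equiv.swap_apply_left, Equiv.swap_apply_right,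
      Equiv.swap_apply_of_ne_of_ne hne hne']
    linear_combination w * edgeWeight_identity_below t (κ ⟨a + 1, by omega⟩)
      (κ ⟨a + 1 + 1, by omega⟩) (κ ⟨i, hi⟩)
  · have hai : i < a := h2 ▸ H0.le_apply (i + 1) hi
    have han : a + 1 < n := by simpa using H2.apply_lt i (by omega)
    have w1 := coloringWeight_update t h hi han hai h2
    have w2 := coloringWeight_update t (Function.update h (i + 1) (a + 1)) (r := i) (b := a)
      (by omega) han hai.le (by rw [Function.update_of_ne (by omega), h1])
    simp only [coeff_chromaticSeries]
    rw [← sub_eq_zero, Finset.mul_sum, Finset.mul_sum, ← Finset.sum_add_distrib,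
      ← Finset.sum_sub_distrib]
    refine sum_coloringsOfContent_eq_zero d
      (Equiv.swap (⟨i, by omega⟩ : Fin n) ⟨i + 1, by omega⟩) _ fun κ => ?_
    obtain ⟨w, hw, hw'⟩ := exists_coloringWeight_swap t hi (by omega) (h1.trans h2.symm)
      (fun j hj => hne j (by omega)) κ
    rw [w2, w1, w2, w1, hw, hw']
    have hne : (⟨a + 1, han⟩ : Fin n) ≠ ⟨i, by omega⟩ := by simp; omega
    have hne' : (⟨a + 1, han⟩ : Fin n) ≠ ⟨i + 1, by omega⟩ := by simp; omega
    simp only [Function.comp, Equiv.swap_apply_left, Equiv.swap_apply_right,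
      Equiv.swap_apply_of_ne_of_ne hne hne']
    linear_combination w * edgeWeight_identity_above t (κ ⟨i, by omega⟩)
      (κ ⟨i + 1, hi⟩) (κ ⟨a + 1, han⟩)

end Chromatic

/-! ### Self-duality of linear operators -/

section Duality

open Module Polynomial

/-- The residue pairing on `F[X] / (g)`: a nondegenerate symmetric form for which the
multiplications are self-adjoint. It takes the classes of `a` and `b` to the coefficient of
`a * b % g` in degree `deg g - 1`. -/
theorem exists_residue_form {F : Type*} [Field F] {g : F[X]} (hg : g ≠ 0) :
    ∃ β : (F[X] ⧸ F[X] ∙ g) → (F[X] ⧸ F[X] ∙ g) → F,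
      (∀ x x' y, β (x + x') y = β x y + β x' y) ∧ (∀ (c : F) x y, β (C c • x) y = c * β x y) ∧
      (∀ x y, β x y = β y x) ∧ (∀ (f : F[X]) x y, β (f • x) y = β x (f • y)) ∧
      ∀ x, x ≠ 0 → ∃ y, β x y ≠ 0 := by
  set L : F[X] → F := fun p => (p % g).coeff (g.natDegree - 1) with hL
  have hLadd : ∀ p p', L (p + p') = L p + L p' := fun p p' => by
    simp only [hL, Polynomial.add_mod, coeff_add]
  have hLdvd : ∀ p p', g ∣ p - p' → L p = L p' := fun p p' h => by
    simp only [hL, Polynomial.mod_eq_of_dvd_sub h]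
  have hLC : ∀ (c : F) p, L (C c * p) = c * L p := fun c p => by
    simp only [hL, ← smul_eq_C_mul, Polynomial.mod_def, smul_modByMonic, coeff_smul, smul_eq_mul]
  have hout : ∀ a : F[X], g ∣ (Submodule.Quotient.mk (p := F[X] ∙ g) a).out - a := by
    intro a
    rw [← Ideal.mem_span_singleton, ← Ideal.submodule_span_eq, ← Submodule.Quotient.eq]
    exact Quotient.out_eq' _
  set β : (F[X] ⧸ F[X] ∙ g) → (F[X] ⧸ F[X] ∙ g) → F := fun x y => L (x.out * y.out) with hβ
  have hmk : ∀ a b : F[X], β (Submodule.Quotient.mk a) (Submodule.Quotient.mk b) = L (a * b) := by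
    intro a b
    refine hLdvd _ _ ?_
    have h1 := (hout a).mul_right (Submodule.Quotient.mk (p := F[X] ∙ g) b).out
    have h2 := (hout b).mul_left a
    have h3 := dvd_add h1 h2
    convert h3 using 1
    ring
  refine ⟨β, fun x x' y => ?_, fun c x y => ?_, fun x y => ?_, fun f x y => ?_, fun x hx => ?_⟩
  · obtain ⟨a, rfl⟩ := Submodule.Quotient.mk_surjective _ x
    obtain ⟨a', rfl⟩ := Submodule.Quotient.mk_surjective _ x'
    obtain ⟨b, rfl⟩ := Submodule.Quotient.mk_surjective _ y
    rw [← Submodule.Quotient.mk_add, hmk, hmk, hmk, add_mul, hLadd]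
  · obtain ⟨a, rfl⟩ := Submodule.Quotient.mk_surjective _ x
    obtain ⟨b, rfl⟩ := Submodule.Quotient.mk_surjective _ y
    rw [← Submodule.Quotient.mk_smul, hmk, hmk, smul_eq_mul, mul_assoc, hLC]
  · simp only [hβ, mul_comm]
  · obtain ⟨a, rfl⟩ := Submodule.Quotient.mk_surjective _ x
    obtain ⟨b, rfl⟩ := Submodule.Quotient.mk_surjective _ y
    rw [← Submodule.Quotient.mk_smul, ← Submodule.Quotient.mk_smul, hmk, hmk, smul_eq_mul,
      smul_eq_mul]
    congr 1
    ring
  · obtain ⟨a, rfl⟩ := Submodule.Quotient.mk_surjective _ x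
    have hr : a % g ≠ 0 := by
      intro h
      apply hx
      rw [Submodule.Quotient.mk_eq_zero, Ideal.submodule_span_eq, Ideal.mem_span_singleton]
      exact EuclideanDomain.mod_eq_zero.1 h
    have hdeg : (a % g).natDegree < g.natDegree :=
      natDegree_lt_natDegree hr (degree_mod_lt a hg)
    set b : F[X] := X ^ (g.natDegree - 1 - (a % g).natDegree) with hb
    refine ⟨Submodule.Quotient.mk b, ?_⟩
    rw [hmk, hLdvd _ (a % g * b)]
    · have h1 : (a % g * b) % g = a % g * b := by
        rw [Polynomial.mod_eq_self_iff hg, hb]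
        refine Polynomial.degree_lt_degree ?_
        rw [natDegree_mul_X_pow _ hr]
        omega
      simp only [hL, h1]
      rw [hb, coeff_mul_X_pow', if_pos (by omega),
        show g.natDegree - 1 - (g.natDegree - 1 - (a % g).natDegree) = (a % g).natDegree by omega]
      simpa using hr
    · rw [← sub_mul]
      refine Dvd.dvd.mul_right ?_ _
      exact ⟨a / g, by linear_combination -(EuclideanDomain.div_add_mod a g)⟩

/-- Every linear operator is self-adjoint for some nondegenerate symmetric form: as a module over
`F[X]`, the space is a direct sum of modules `F[X] / (g)`. -/
theorem exists_selfAdjoint_form {F V : Type*} [Field F] [AddCommGroup V] [Module F V]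
    [FiniteDimensional F V] (T : V →ₗ[F] V) :
    ∃ B : LinearMap.BilinForm F V, B.Nondegenerate ∧ B.IsSymm ∧ ∀ x y, B (T x) y = B x (T y) := by
  classical
  obtain ⟨ι, _, p, hp, e, ⟨φ⟩⟩ := Module.equiv_directSum_of_isTorsion
    (Module.AEval.isTorsion_of_finiteDimensional F V T)
  choose β hadd hsmul hsymm hself hnd using fun i =>
    exists_residue_form (g := p i ^ e i) (pow_ne_zero _ (hp i).ne_zero)
  let ψ : V → ∀ i, F[X] ⧸ F[X] ∙ (p i ^ e i) := fun v i => φ (Module.AEval.of F V T v) i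
  have hψadd : ∀ v w i, ψ (v + w) i = ψ v i + ψ w i := fun v w i => by simp [ψ]
  have hψsmul : ∀ (c : F) v i, ψ (c • v) i = (C c : F[X]) • ψ v i := fun c v i => by
    simp only [ψ]
    rw [← DirectSum.smul_apply, ← map_smul, Module.AEval.C_smul, map_smul]
  have hψT : ∀ v i, ψ (T v) i = (X : F[X]) • ψ v i := fun v i => by
    simp only [ψ]
    rw [← DirectSum.smul_apply, ← map_smul, Module.AEval.X_smul_of]
    rfl
  have hadd' : ∀ i x y y', β i x (y + y') = β i x y + β i x y' := fun i x y y' => by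
    rw [hsymm, hadd, hsymm i y, hsymm i y']
  have hsmul' : ∀ i (c : F) x y, β i x ((C c : F[X]) • y) = c * β i x y := fun i c x y => by
    rw [hsymm, hsmul, hsymm i y]
  let B : LinearMap.BilinForm F V := LinearMap.mk₂ F (fun v w => ∑ i, β i (ψ v i) (ψ w i))
    (fun v v' w => by simp only [hψadd, hadd, Finset.sum_add_distrib])
    (fun c v w => by simp only [hψsmul, hsmul, ← Finset.mul_sum, smul_eq_mul])
    (fun v w w' => by simp only [hψadd, hadd', Finset.sum_add_distrib])
    (fun c v w => by simp only [hψsmul, hsmul', ← Finset.mul_sum, smul_eq_mul])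
  have hB : ∀ v w, B v w = ∑ i, β i (ψ v i) (ψ w i) := fun v w => rfl
  have hBs : ∀ v w, B v w = B w v := fun v w => by
    rw [hB, hB]
    exact Finset.sum_congr rfl fun i _ => hsymm i _ _
  have hsep : ∀ v, (∀ w, B v w = 0) → v = 0 := by
    intro v hv
    by_contra hne
    obtain ⟨i, hi⟩ : ∃ i, ψ v i ≠ 0 := by
      by_contra! h
      apply hne
      have : φ (Module.AEval.of F V T v) = 0 := by
        ext i
        exact h i
      simpa using this
    obtain ⟨y, hy⟩ := hnd i _ hi
    have h0 : ∀ i x, β i x 0 = 0 := fun i x => by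
      have := hsmul' i 0 x 0
      simpa using this
    apply hy
    have hw := hv ((Module.AEval.of F V T).symm (φ.symm (DirectSum.of _ i y)))
    rw [hB, Finset.sum_eq_single i] at hw
    · simpa [ψ] using hw
    · intro j _ hj
      have : ψ ((Module.AEval.of F V T).symm (φ.symm (DirectSum.of _ i y))) j = 0 := by
        simp only [ψ, LinearEquiv.apply_symm_apply]
        exact DirectSum.of_eq_of_ne _ _ _ hj
      rw [this, h0]
    · simp
  refine ⟨B, ⟨hsep, fun v hv => hsep v fun w => ?_⟩, ⟨fun v w => ?_⟩, fun v w => ?_⟩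
  · rw [hBs]; exact hv w
  · simpa using hBs v w
  · rw [hB, hB]
    refine Finset.sum_congr rfl fun i _ => ?_
    rw [hψT, hψT, hself]

/-- An operator on a space of dimension `a + b` has as many invariant subspaces of dimension `a`
as of dimension `b`. -/
theorem ncard_invariant_eq {F V : Type*} [Field F] [AddCommGroup V] [Module F V]
    [FiniteDimensional F V] (T : V →ₗ[F] V) {a b : ℕ} (hab : finrank F V = a + b) :
    {P : Submodule F V | P.map T ≤ P ∧ finrank F P = a}.ncard =
      {P : Submodule F V | P.map T ≤ P ∧ finrank F P = b}.ncard := by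
  obtain ⟨B, hnd, hsymm, hself⟩ := exists_selfAdjoint_form T
  have hinv : ∀ P : Submodule F V, P.map T ≤ P → (B.orthogonal P).map T ≤ B.orthogonal P := by
    rintro P hP _ ⟨x, hx, rfl⟩
    rw [SetLike.mem_coe, LinearMap.BilinForm.mem_orthogonal_iff] at hx
    rw [LinearMap.BilinForm.mem_orthogonal_iff]
    intro y hy
    have := hx (T y) (hP ⟨y, hy, rfl⟩)
    change B (T y) x = 0 at this
    change B y (T x) = 0
    rw [← hself, this]
  have hoo := LinearMap.BilinForm.orthogonal_orthogonal hnd hsymm.isRefl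
  refine Set.ncard_congr (fun P _ => B.orthogonal P) (fun P hP => ?_) (fun P Q _ _ h => ?_)
    fun P hP => ⟨B.orthogonal P, ⟨hinv P hP.1, ?_⟩, hoo P⟩
  · refine ⟨hinv P hP.1, ?_⟩
    rw [LinearMap.BilinForm.finrank_orthogonal hnd, hab, hP.2, Nat.add_sub_cancel_left]
  · rw [← hoo P, h, hoo]
  · rw [LinearMap.BilinForm.finrank_orthogonal hnd, hab, hP.2, Nat.add_sub_cancel]

/-- The same for the invariant subspaces between two given ones, `W ⊆ U`, by passing to
`U / W`. -/
theorem ncard_invariant_between_eq {F E : Type*} [Field F] [AddCommGroup E] [Module F E]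
    [FiniteDimensional F E] (T : E →ₗ[F] E) {W U : Submodule F E} (hWU : W ≤ U)
    (hW : W.map T ≤ W) (hU : U.map T ≤ U) {a b : ℕ} (hab : finrank F U = finrank F W + (a + b)) :
    {P : Submodule F E | W ≤ P ∧ P ≤ U ∧ P.map T ≤ P ∧ finrank F P = finrank F W + a}.ncard =
      {P : Submodule F E | W ≤ P ∧ P ≤ U ∧ P.map T ≤ P ∧ finrank F P = finrank F W + b}.ncard := by
  have hUT : ∀ x ∈ U, T x ∈ U := fun x hx => hU ⟨x, hx, rfl⟩
  set W' : Submodule F U := W.comap U.subtype with hW'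
  have hWT : W' ≤ W'.comap (T.restrict hUT) := by
    intro x hx
    exact hW ⟨x, hx, rfl⟩
  set S : (U ⧸ W') →ₗ[F] (U ⧸ W') := W'.mapQ W' (T.restrict hUT) hWT with hS
  have hW'fin : finrank F W' = finrank F W := (Submodule.comapSubtypeEquivOfLe hWU).finrank_eq
  have hQ : finrank F (U ⧸ W') = a + b := by
    have := Submodule.finrank_quotient_add_finrank W'
    omega
  let Φ : Submodule F (U ⧸ W') → Submodule F E := fun P => (P.comap W'.mkQ).map U.subtype
  have hΦinj : Function.Injective Φ := fun P P' h =>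
    Submodule.comap_injective_of_surjective W'.mkQ_surjective
      (Submodule.map_injective_of_injective U.subtype_injective h)
  have hmem : ∀ P (x : U), (x : E) ∈ Φ P ↔ W'.mkQ x ∈ P := by
    intro P x
    simp [Φ]
  have hfin : ∀ P, finrank F (Φ P) = finrank F W + finrank F P := by
    intro P
    have h1 : finrank F (Φ P) = finrank F (P.comap W'.mkQ) :=
      LinearEquiv.finrank_eq (Submodule.equivSubtypeMap U _).symm
    have h2 := LinearMap.finrank_range_add_finrank_ker (W'.mkQ.domRestrict (P.comap W'.mkQ))
    rw [LinearMap.range_domRestrict, LinearMap.ker_domRestrict, Submodule.ker_mkQ,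
      Submodule.map_comap_eq_of_surjective W'.mkQ_surjective] at h2
    have h3 : finrank F (W'.comap (P.comap W'.mkQ).subtype) = finrank F W' :=
      (Submodule.comapSubtypeEquivOfLe (Submodule.le_comap_mkQ W' P)).finrank_eq
    omega
  have hinv : ∀ P, (Φ P).map T ≤ Φ P ↔ P.map S ≤ P := by
    intro P
    constructor
    · rintro h _ ⟨y, hy, rfl⟩
      obtain ⟨x, rfl⟩ := W'.mkQ_surjective y
      have : T x ∈ Φ P := h ⟨x, (hmem P x).2 hy, rfl⟩
      exact (hmem P (T.restrict hUT x)).1 this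
    · rintro h _ ⟨y, ⟨x, hx, rfl⟩, rfl⟩
      exact (hmem P (T.restrict hUT x)).2 (h ⟨_, hx, rfl⟩)
  have himage : ∀ c, {P : Submodule F E | W ≤ P ∧ P ≤ U ∧ P.map T ≤ P ∧
      finrank F P = finrank F W + c} = Φ '' {P | P.map S ≤ P ∧ finrank F P = c} := by
    intro c
    have hWΦ : ∀ P, W ≤ Φ P := fun P x hx => (hmem P ⟨x, hWU hx⟩).2 (by
      rw [Submodule.mkQ_apply, (Submodule.Quotient.mk_eq_zero _).2]
      · exact P.zero_mem
      · exact hx)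
    have hΦU : ∀ P, Φ P ≤ U := fun P => Submodule.map_subtype_le U _
    ext Q
    constructor
    · rintro ⟨h1, h2, h3, h4⟩
      have hΦQ : Φ ((Q.comap U.subtype).map W'.mkQ) = Q := by
        simp only [Φ]
        rw [Submodule.comap_map_mkQ, sup_eq_right.2 (Submodule.comap_mono h1),
          Submodule.map_comap_subtype, inf_eq_right.2 h2]
      refine ⟨_, ⟨(hinv _).1 (by rwa [hΦQ]), ?_⟩, hΦQ⟩
      have := hfin ((Q.comap U.subtype).map W'.mkQ)
      rw [hΦQ] at this
      omega
    · rintro ⟨P, ⟨h1, h2⟩, rfl⟩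
      exact ⟨hWΦ P, hΦU P, (hinv P).2 h1, by rw [hfin, h2]⟩
  rw [himage, himage, Set.ncard_image_of_injective _ hΦinj, Set.ncard_image_of_injective _ hΦinj]
  exact ncard_invariant_eq S hQ

end Duality

/-! ### Counting chains of subspaces -/

section Chains

open Module

variable {F E : Type*} [Field F] [AddCommGroup E] [Module F E] [Finite E]

/-- The possible next members of a chain of subspaces that has arrived at `W`: the dimension has
to grow by `s.1`, and the new member has to be invariant if `s.2` says so. -/
noncomputable def nextSteps (T : E →ₗ[F] E) (s : ℕ × Bool) (W : Submodule F E) :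
    Finset (Submodule F E) :=
  (Set.toFinite {W' | W ≤ W' ∧ finrank F W' = finrank F W + s.1 ∧
    (s.2 = true → W'.map T ≤ W')}).toFinset

theorem mem_nextSteps {T : E →ₗ[F] E} {s : ℕ × Bool} {W W' : Submodule F E} :
    W' ∈ nextSteps T s W ↔
      W ≤ W' ∧ finrank F W' = finrank F W + s.1 ∧ (s.2 = true → W'.map T ≤ W') := by
  simp [nextSteps]

/-- The number of chains of subspaces that start at a given one and take the given steps. -/
noncomputable def chainCount (T : E →ₗ[F] E) : List (ℕ × Bool) → Submodule F E → ℕ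
  | [], _ => 1
  | s :: L, W => ∑ W' ∈ nextSteps T s W, chainCount T L W'

theorem ncard_chains (T : E →ₗ[F] E) : ∀ (k : ℕ) (s : Fin k → ℕ × Bool) (W : Submodule F E),
    {V : Fin (k + 1) → Submodule F E |
      V 0 = W ∧ ∀ i : Fin k, V i.succ ∈ nextSteps T (s i) (V i.castSucc)}.ncard =
      chainCount T (List.ofFn s) W := by
  classical
  intro k
  induction k with
  | zero =>
    intro s W
    have : {V : Fin (0 + 1) → Submodule F E |
      V 0 = W ∧ ∀ i : Fin 0, V i.succ ∈ nextSteps T (s i) (V i.castSucc)} = {fun _ => W} := by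
      ext V
      simp only [Set.mem_ofPred_eq, IsEmpty.forall_iff, and_true, Set.mem_singleton_iff]
      constructor
      · rintro rfl
        funext i
        exact congrArg V (Fin.ext (by omega))
      · rintro rfl; rfl
    rw [this, Set.ncard_singleton, List.ofFn_zero, chainCount]
  | succ k ih =>
    intro s W
    rw [List.ofFn_succ, chainCount, Set.ncard_eq_toFinset_card _ (Set.toFinite _),
      Finset.card_eq_sum_card_fiberwise (f := fun V => V 1) (t := nextSteps T (s 0) W)]
    · refine Finset.sum_congr rfl fun W' hW' => ?_
      rw [← ih, Set.ncard_eq_toFinset_card _ (Set.toFinite _),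
        ← Finset.card_image_of_injective _
          (Fin.cons_right_injective (α := fun _ : Fin (k + 2) => Submodule F E) W)]
      congr 1
      ext V
      simp only [Finset.mem_filter, Set.Finite.mem_toFinset, Set.mem_ofPred_eq, Finset.mem_image]
      constructor
      · rintro ⟨⟨h0, hs⟩, h1⟩
        refine ⟨Fin.tail V, ⟨h1, fun i => ?_⟩, ?_⟩
        · exact hs i.succ
        · rw [← h0, Fin.cons_self_tail]
      · rintro ⟨V', ⟨h0, hs⟩, rfl⟩
        refine ⟨⟨rfl, fun i => ?_⟩, h0⟩
        refine Fin.cases ?_ (fun i => ?_) i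
        · change V' 0 ∈ nextSteps T (s 0) W
          rwa [h0]
        · exact hs i
    · intro V hV
      rw [Finset.mem_coe, Set.Finite.mem_toFinset] at hV
      have := hV.2 0
      rw [Fin.castSucc_zero, hV.1] at this
      exact this

/-- The `q`-factorial `[k]! = ∏ i < k, (1 + q + ⋯ + q ^ i)`. -/
def qFactorial (q k : ℕ) : ℕ := ∏ i ∈ Finset.range k, ∑ j ∈ Finset.range (i + 1), q ^ j

/-- An unrestricted step of dimension one followed by a step to an invariant subspace: each
choice of the latter leaves a fixed number of choices for the former. -/
theorem chainCount_merge [Finite F] (T : E →ₗ[F] E) (k : ℕ) (L : List (ℕ × Bool))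
    (W : Submodule F E) :
    chainCount T ((1, false) :: (k + 1, true) :: L) W =
      (∑ j ∈ Finset.range (k + 2), Nat.card F ^ j) * chainCount T ((k + 2, true) :: L) W := by
  simp only [chainCount]
  rw [Finset.sum_comm' (t' := nextSteps T (k + 2, true) W) (s' := fun W'' => coversBetween W W'')]
  · rw [Finset.mul_sum]
    refine Finset.sum_congr rfl fun W'' hW'' => ?_
    rw [mem_nextSteps] at hW''
    rw [Finset.sum_const, smul_eq_mul]
    congr 1
    have := card_coversBetween hW''.1
    rw [hW''.2.1, Nat.add_sub_cancel_left] at this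
    exact_mod_cast this
  · intro W' W''
    simp only [mem_nextSteps, mem_coversBetween, Bool.false_eq_true, false_implies, and_true,
      true_implies]
    constructor
    · rintro ⟨⟨h1, h2⟩, h3, h4, h5⟩
      exact ⟨⟨h1, h3, h2⟩, h1.trans h3, by omega, h5⟩
    · rintro ⟨⟨h1, h3, h2⟩, _, h4, h5⟩
      exact ⟨⟨h1, h2⟩, h3, by omega, h5⟩

theorem chainCount_replicate [Finite F] (T : E →ₗ[F] E) (L : List (ℕ × Bool)) (k : ℕ) :
    ∀ W : Submodule F E, chainCount T (List.replicate k (1, false) ++ (1, true) :: L) W =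
      qFactorial (Nat.card F) (k + 1) * chainCount T ((k + 1, true) :: L) W := by
  induction k with
  | zero => intro W; simp [qFactorial]
  | succ k ih =>
    intro W
    rw [List.replicate_succ, List.cons_append, chainCount, Finset.sum_congr rfl fun W' _ => ih W',
      ← Finset.mul_sum, ← chainCount.eq_2, chainCount_merge, ← mul_assoc, qFactorial, qFactorial,
      Finset.prod_range_succ _ (k + 1)]

/-- The lengths of the blocks into which a list is cut after each of its members `true`; the first
block is longer by `k`. -/
def blockLengths : ℕ → List Bool → List ℕ
  | _, [] => []
  | k, true :: l => (k + 1) :: blockLengths 0 l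
  | k, false :: l => blockLengths (k + 1) l

/-- Inside a block, flags of subspaces can be chosen freely. -/
theorem chainCount_blockLengths [Finite F] (T : E →ₗ[F] E) : ∀ (l : List Bool) (k : ℕ),
    (l = [] ∧ k = 0 ∨ l.getLast? = some true) → ∀ W : Submodule F E,
    chainCount T (List.replicate k (1, false) ++ l.map fun b => (1, b)) W =
      ((blockLengths k l).map (qFactorial (Nat.card F))).prod *
        chainCount T ((blockLengths k l).map fun a => (a, true)) W := by
  intro l
  induction l with
  | nil =>
    rintro k (⟨_, rfl⟩ | h) W
    · simp [blockLengths, chainCount]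
    · simp at h
  | cons b l ih =>
    intro k hl W
    have hl' : (b :: l).getLast? = some true := by simpa using hl
    cases b with
    | true =>
      have hl0 : l = [] ∧ 0 = 0 ∨ l.getLast? = some true := by
        cases l with
        | nil => simp
        | cons c l => right; simpa using hl'
      rw [List.map_cons, chainCount_replicate, blockLengths, List.map_cons, List.map_cons,
        List.prod_cons, chainCount, chainCount, mul_assoc, Finset.mul_sum _ _ (List.prod _)]
      congr 1
      refine Finset.sum_congr rfl fun W' _ => ?_
      simpa using ih 0 hl0 W'
    | false =>
      have hl0 : l = [] ∧ k + 1 = 0 ∨ l.getLast? = some true := by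
        cases l with
        | nil => simp at hl'
        | cons c l => right; simpa using hl'
      rw [blockLengths, ← ih (k + 1) hl0, List.map_cons, List.append_cons,
        ← List.replicate_succ']

/-- The number of chains of invariant subspaces with given dimension steps does not depend on the
order of the steps. -/
theorem chainCount_perm (T : E →ₗ[F] E) {L L' : List ℕ} (h : L.Perm L') :
    ∀ W : Submodule F E, W.map T ≤ W →
      chainCount T (L.map fun a => (a, true)) W = chainCount T (L'.map fun a => (a, true)) W := by
  induction h with
  | nil => intro W _; rfl
  | cons a _ ih =>
    intro W _
    simp only [List.map_cons, chainCount]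
    exact Finset.sum_congr rfl fun W' hW' => ih W' ((mem_nextSteps.1 hW').2.2 rfl)
  | trans _ _ ih1 ih2 => intro W hW; rw [ih1 W hW, ih2 W hW]
  | swap a b L =>
    intro W hW
    -- Summing over the end `U` of both steps first, one has to count the subspaces in between.
    have key : ∀ c d : ℕ, chainCount T ((c, true) :: (d, true) :: L.map fun a => (a, true)) W =
        ∑ U ∈ nextSteps T (c + d, true) W,
          {P : Submodule F E | W ≤ P ∧ P ≤ U ∧ P.map T ≤ P ∧
            finrank F P = finrank F W + c}.ncard * chainCount T (L.map fun a => (a, true)) U := by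
      intro c d
      simp only [chainCount]
      rw [Finset.sum_comm' (t' := nextSteps T (c + d, true) W)
        (s' := fun U => (Set.toFinite {P : Submodule F E | W ≤ P ∧ P ≤ U ∧ P.map T ≤ P ∧
            finrank F P = finrank F W + c}).toFinset)]
      · refine Finset.sum_congr rfl fun U _ => ?_
        rw [Finset.sum_const, smul_eq_mul, Set.ncard_eq_toFinset_card _ (Set.toFinite _)]
      · intro P U
        simp only [mem_nextSteps, true_implies, Set.Finite.mem_toFinset, Set.mem_ofPred_eq]
        constructor
        · rintro ⟨⟨h1, h2, h3⟩, h4, h5, h6⟩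
          exact ⟨⟨h1, h4, h3, h2⟩, h1.trans h4, by omega, h6⟩
        · rintro ⟨⟨h1, h4, h3, h2⟩, _, h5, h6⟩
          exact ⟨⟨h1, h2, h3⟩, h4, by omega, h6⟩
    rw [List.map_cons, List.map_cons, List.map_cons, List.map_cons, key, key, add_comm a b]
    refine Finset.sum_congr rfl fun U hU => ?_
    rw [mem_nextSteps] at hU
    rw [ncard_invariant_between_eq T hU.1 hW (hU.2.2 rfl) hU.2.1]

end Chains

/-! ### Disjoint unions of cliques -/

section Cliques

theorem sum_coloringsOfContent_add {a b : ℕ} (d : ℕ →₀ ℕ) (G : (Fin (a + b) → ℕ) → ℤ) :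
    ∑ κ ∈ coloringsOfContent (a + b) d, G κ =
      ∑ p ∈ Finset.HasAntidiagonal.antidiagonal d, ∑ κ₁ ∈ coloringsOfContent a p.1,
        ∑ κ₂ ∈ coloringsOfContent b p.2, G (Fin.append κ₁ κ₂) := by
  simp_rw [Finset.sum_sigma']
  refine Finset.sum_bij'
    (fun κ _ => ⟨(∑ v, Finsupp.single (κ (Fin.castAdd b v)) 1,
      ∑ v, Finsupp.single (κ (Fin.natAdd a v)) 1), fun v => κ (Fin.castAdd b v),
      fun v => κ (Fin.natAdd a v)⟩)
    (fun x _ => Fin.append x.2.1 x.2.2) ?_ ?_ ?_ ?_ ?_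
  · intro κ hκ
    rw [mem_coloringsOfContent, Fin.sum_univ_add] at hκ
    simp [mem_coloringsOfContent, hκ]
  · rintro ⟨⟨d₁, d₂⟩, κ₁, κ₂⟩ hx
    simp only [Finset.mem_sigma, Finset.HasAntidiagonal.mem_antidiagonal,
      mem_coloringsOfContent] at hx
    rw [mem_coloringsOfContent, Fin.sum_univ_add]
    simp [hx]
  · intro κ _
    exact Fin.append_castAdd_natAdd
  · rintro ⟨⟨d₁, d₂⟩, κ₁, κ₂⟩ hx
    simp only [Finset.mem_sigma, Finset.HasAntidiagonal.mem_antidiagonal,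
      mem_coloringsOfContent] at hx
    obtain ⟨_, rfl, rfl⟩ := hx
    simp
  · intro κ _
    rw [Fin.append_castAdd_natAdd]

/-- The chromatic quasisymmetric function of a disjoint union is the product of those of the two
parts. -/
theorem chromaticSeries_add (t : ℤ) {a b : ℕ} {h : ℕ → ℕ} (hlt : ∀ i < a, h i < a)
    (hge : ∀ i < b, a ≤ h (i + a)) :
    chromaticSeries t (a + b) h =
      chromaticSeries t a h * chromaticSeries t b fun i => h (i + a) - a := by
  classical
  ext d
  rw [coeff_chromaticSeries, sum_coloringsOfContent_add, MvPowerSeries.coeff_mul]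
  refine Finset.sum_congr rfl fun p _ => ?_
  rw [coeff_chromaticSeries, coeff_chromaticSeries, Finset.sum_mul_sum]
  refine Finset.sum_congr rfl fun κ₁ _ => Finset.sum_congr rfl fun κ₂ _ => ?_
  simp only [coloringWeight]
  rw [Fin.prod_univ_add]
  congr 1
  · refine Finset.prod_congr rfl fun i _ => ?_
    rw [Fin.prod_univ_add]
    rw [Finset.prod_eq_one (f := fun j : Fin b => _) fun j _ => if_neg ?_, mul_one]
    · refine Finset.prod_congr rfl fun j _ => ?_
      rw [Fin.append_left, Fin.append_left]
      exact if_congr (by rw [Fin.lt_def, Fin.lt_def]; rfl) rfl rfl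
    · rintro ⟨_, h2⟩
      have := hlt i i.2
      simp only [Fin.val_natAdd, Fin.val_castAdd] at h2
      omega
  · refine Finset.prod_congr rfl fun i _ => ?_
    rw [Fin.prod_univ_add]
    rw [Finset.prod_eq_one (f := fun j : Fin a => _) fun j _ => if_neg ?_, one_mul]
    · refine Finset.prod_congr rfl fun j _ => ?_
      rw [Fin.append_right, Fin.append_right]
      refine if_congr ?_ rfl rfl
      have := hge i i.2
      simp only [Fin.lt_def, Fin.val_natAdd]
      rw [add_comm a (i : ℕ)]
      omega
    · rintro ⟨h1, _⟩
      simp only [Fin.lt_def, Fin.val_natAdd, Fin.val_castAdd] at h1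
      omega

theorem sum_coloringsOfContent_succ {a : ℕ} (d : ℕ →₀ ℕ) (G : (Fin (a + 1) → ℕ) → ℤ) :
    ∑ κ ∈ coloringsOfContent (a + 1) d, G κ =
      ∑ x ∈ d.support, ∑ κ ∈ coloringsOfContent a (d - Finsupp.single x 1),
        G (Fin.snoc (α := fun _ => ℕ) κ x) := by
  rw [Finset.sum_sigma']
  refine Finset.sum_bij' (fun κ _ => ⟨κ (Fin.last a), Fin.init κ⟩)
    (fun x _ => Fin.snoc (α := fun _ => ℕ) x.2 x.1) ?_ ?_ ?_ ?_ ?_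
  · intro κ hκ
    rw [mem_coloringsOfContent, Fin.sum_univ_castSucc] at hκ
    rw [Finset.mem_sigma, mem_coloringsOfContent, ← hκ]
    refine ⟨?_, ?_⟩
    · simp
    · rw [add_tsub_cancel_right]
      rfl
  · rintro ⟨x, κ⟩ hx
    rw [Finset.mem_sigma, mem_coloringsOfContent, Finsupp.mem_support_iff] at hx
    rw [mem_coloringsOfContent, Fin.sum_univ_castSucc]
    simp only [Fin.snoc_castSucc, Fin.snoc_last, hx.2]
    refine tsub_add_cancel_of_le ?_
    rw [Finsupp.single_le_iff]
    exact Nat.one_le_iff_ne_zero.2 hx.1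
  · intro κ _
    exact Fin.snoc_init_self κ
  · rintro ⟨x, κ⟩ _
    simp
  · intro κ _
    rw [Fin.snoc_init_self]

theorem sum_card_filter_lt (S : Finset ℕ) (f : ℕ → ℤ) :
    ∑ x ∈ S, f {y ∈ S | y < x}.card = ∑ i ∈ Finset.range S.card, f i := by
  induction S using Finset.induction_on_max with
  | empty => simp
  | insert m S hm ih =>
    have hmS : m ∉ S := fun h => (hm m h).false
    rw [Finset.sum_insert hmS, Finset.card_insert_of_notMem hmS, Finset.sum_range_succ, ← ih,
      add_comm]
    congr 1
    · refine Finset.sum_congr rfl fun x hx => ?_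
      rw [Finset.filter_insert, if_neg (hm x hx).not_gt]
    · rw [Finset.filter_insert, if_neg (lt_irrefl m), Finset.filter_true_of_mem hm]

/-- The chromatic quasisymmetric function of the complete graph is `[a]! * e a`. The last vertex
may get any of the colors in use, and then the earlier vertices with smaller colors contribute
a factor `q` each. -/
theorem chromaticSeries_clique (q a : ℕ) {h : ℕ → ℕ} (hh : ∀ i < a, a ≤ h i + 1) :
    chromaticSeries q a h =
      ((qFactorial q a • SymmFun.e ℤ a : SymmFun ℤ) : MvPowerSeries ℕ ℤ) := by
  classical
  have hw : ∀ κ : Fin a → ℕ, coloringWeight q a h κ =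
      ∏ i : Fin a, ∏ j : Fin a, if i < j then edgeWeight q (κ i) (κ j) else 1 := by
    intro κ
    refine Finset.prod_congr rfl fun i _ => Finset.prod_congr rfl fun j _ => ?_
    refine if_congr (and_iff_left ?_) rfl rfl
    have := hh i i.2
    omega
  ext d
  rw [coeff_chromaticSeries, show ((qFactorial q a • SymmFun.e ℤ a : SymmFun ℤ) :
    MvPowerSeries ℕ ℤ) = qFactorial q a • (SymmFun.e ℤ a : MvPowerSeries ℕ ℤ) from
    map_nsmul (SymmFun ℤ).val _ _, map_nsmul, nsmul_eq_mul, SymmFun.coeff_e]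
  simp only [hw]
  clear hw hh h
  induction a generalizing d with
  | zero =>
    by_cases hd : d = 0
    · subst hd
      have : coloringsOfContent 0 (0 : ℕ →₀ ℕ) = Finset.univ := by
        ext κ
        simp only [mem_coloringsOfContent, Finset.univ_eq_empty, Finset.sum_empty,
          Finset.mem_univ]
      rw [this]
      simp [qFactorial]
    · have : coloringsOfContent 0 d = ∅ := by
        ext κ
        simpa [mem_coloringsOfContent] using Ne.symm hd
      rw [this, if_neg]
      · simp
      · rw [Finsupp.degree_eq_zero_iff]
        exact fun h => hd h.1
  | succ a ih =>
    rw [sum_coloringsOfContent_succ]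
    have h1 : ∀ x ∈ d.support, ∀ κ ∈ coloringsOfContent a (d - Finsupp.single x 1),
        (∏ i : Fin (a + 1), ∏ j : Fin (a + 1), if i < j then
          edgeWeight q (Fin.snoc (α := fun _ => ℕ) κ x i) (Fin.snoc (α := fun _ => ℕ) κ x j)
          else 1) =
        (∏ i : Fin a, ∏ j : Fin a, if i < j then edgeWeight q (κ i) (κ j) else 1) *
          (d - Finsupp.single x 1).prod fun y k => edgeWeight q y x ^ k := by
      intro x _ κ hκ
      rw [mem_coloringsOfContent] at hκ
      rw [← hκ, ← Finsupp.prod_finsetSum_index (by simp) (by simp [pow_add]),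
        Fin.prod_univ_castSucc, Finset.prod_eq_one (f := fun j : Fin (a + 1) =>
          if Fin.last a < j then _ else 1) fun j _ => if_neg (Fin.le_last j).not_gt, mul_one,
        ← Finset.prod_mul_distrib]
      refine Finset.prod_congr rfl fun i _ => ?_
      rw [Fin.prod_univ_castSucc, if_pos (Fin.castSucc_lt_last i), Fin.snoc_castSucc,
        Fin.snoc_last, Finsupp.prod_single_index (by simp), pow_one]
      simp only [Fin.snoc_castSucc, Fin.castSucc_lt_castSucc_iff]
    rw [Finset.sum_congr rfl fun x hx => by
      rw [Finset.sum_congr rfl (h1 x hx), ← Finset.sum_mul, ih]]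
    have hdeg : ∀ x ∈ d.support, d.degree = (d - Finsupp.single x 1).degree + 1 := by
      intro x hx
      rw [Finsupp.mem_support_iff] at hx
      have : Finsupp.single x 1 ≤ d := by rw [Finsupp.single_le_iff]; omega
      conv_lhs => rw [← tsub_add_cancel_of_le this, map_add, Finsupp.degree_single]
    by_cases hd : d.degree = a + 1 ∧ ∀ i, d i ≤ 1
    · have h2 : ∀ x ∈ d.support, (((qFactorial q a : ℕ) : ℤ) *
          (if (d - Finsupp.single x 1).degree = a ∧ ∀ i, (d - Finsupp.single x 1 : ℕ →₀ ℕ) i ≤ 1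
            then 1 else 0) *
          (d - Finsupp.single x 1).prod fun y k => edgeWeight q y x ^ k) =
          qFactorial q a * (q : ℤ) ^ {y ∈ d.support | y < x}.card := by
        intro x hx
        have h3 : ∀ y, (d - Finsupp.single x 1 : ℕ →₀ ℕ) y = if y = x then 0 else d y := by
          intro y
          have := hd.2 y
          rw [Finsupp.tsub_apply, Finsupp.single_apply]
          by_cases hy : y = x
          · rw [if_pos hy, if_pos hy.symm]; omega
          · rw [if_neg hy, if_neg (Ne.symm hy), tsub_zero]
        rw [if_pos ⟨by have := hdeg x hx; omega, fun i => by
          rw [h3]; have := hd.2 i; split_ifs <;> omega⟩, mul_one]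
        congr 1
        rw [Finsupp.prod_of_support_subset _ Finsupp.support_tsub _ (by simp),
          ← Finset.prod_const, ← Finset.prod_filter_mul_prod_filter_not d.support (· < x),
          Finset.prod_eq_one (s := {y ∈ d.support | ¬ y < x}), mul_one]
        · refine Finset.prod_congr rfl fun y hy => ?_
          rw [Finset.mem_filter, Finsupp.mem_support_iff] at hy
          have := hd.2 y
          rw [h3, if_neg hy.2.ne, show d y = 1 by omega, pow_one, edgeWeight, if_neg hy.2.ne,
            if_pos hy.2]
        · intro y hy
          rw [Finset.mem_filter, Finsupp.mem_support_iff] at hy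
          rw [h3]
          split_ifs with hyx
          · rw [pow_zero]
          · rw [edgeWeight, if_neg hyx, if_neg hy.2, one_pow]
      rw [Finset.sum_congr rfl h2, ← Finset.mul_sum,
        sum_card_filter_lt d.support fun i => (q : ℤ) ^ i, if_pos hd, mul_one]
      have hcard : d.support.card = a + 1 := by
        rw [← hd.1, Finsupp.degree_apply, Finset.card_eq_sum_ones]
        refine Finset.sum_congr rfl fun i hi => ?_
        have := hd.2 i
        rw [Finsupp.mem_support_iff] at hi
        omega
      rw [hcard, qFactorial, qFactorial, Finset.prod_range_succ]
      push_cast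
      rfl
    · rw [if_neg hd, mul_zero]
      refine Finset.sum_eq_zero fun x hx => ?_
      by_cases h3 : (d - Finsupp.single x 1).degree = a ∧
          ∀ i, (d - Finsupp.single x 1 : ℕ →₀ ℕ) i ≤ 1
      · have h4 : (d - Finsupp.single x 1 : ℕ →₀ ℕ) x ≠ 0 := by
          intro h4
          refine hd ⟨by have := hdeg x hx; omega, fun i => ?_⟩
          have h5 := h3.2 i
          rw [Finsupp.tsub_apply, Finsupp.single_apply] at h4 h5
          by_cases hi : x = i
          · subst hi
            simp only [if_true] at h4
            omega
          · rw [if_neg hi] at h5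
            omega
        rw [Finsupp.prod, Finset.prod_eq_zero (Finsupp.mem_support_iff.2 h4), mul_zero]
        rw [edgeWeight, if_pos rfl, zero_pow h4]
      · rw [if_neg h3, mul_zero, zero_mul]

/-- For a Hessenberg function, which rows end on the diagonal; for an idempotent one, these are the
last vertices of the cliques. -/
def diagonalRows (n : ℕ) (h : ℕ → ℕ) : List Bool := (List.range n).map fun i => decide (h i = i)

theorem blockLengths_replicate (k c : ℕ) (l : List Bool) :
    blockLengths k (List.replicate c false ++ l) = blockLengths (k + c) l := by
  induction c generalizing k with
  | zero => rfl
  | succ c ih =>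
    rw [List.replicate_succ, List.cons_append, blockLengths, ih]
    congr 1
    omega

theorem blockLengths_pos : ∀ (l : List Bool) (k : ℕ), ∀ a ∈ blockLengths k l, 0 < a
  | [], _ => by simp [blockLengths]
  | true :: l, k => by
    intro a ha
    rw [blockLengths, List.mem_cons] at ha
    rcases ha with rfl | ha
    · omega
    · exact blockLengths_pos l 0 a ha
  | false :: l, k => blockLengths_pos l (k + 1)

theorem sum_blockLengths : ∀ (l : List Bool) (k : ℕ), (l = [] ∧ k = 0 ∨ l.getLast? = some true) →
    (blockLengths k l).sum = k + l.length
  | [], k, h => by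
    rcases h with ⟨_, rfl⟩ | h
    · rfl
    · simp at h
  | true :: l, k, h => by
    have h0 : l = [] ∧ 0 = 0 ∨ l.getLast? = some true := by
      cases l with
      | nil => simp
      | cons c l => right; simpa using h
    rw [blockLengths, List.sum_cons, sum_blockLengths l 0 h0, List.length_cons]
    omega
  | false :: l, k, h => by
    have h0 : l = [] ∧ k + 1 = 0 ∨ l.getLast? = some true := by
      cases l with
      | nil => simp at h
      | cons c l => right; simpa using h
    rw [blockLengths, sum_blockLengths l (k + 1) h0, List.length_cons]
    omega

theorem HessenbergOn.diagonalRows_getLast {n : ℕ} {h : ℕ → ℕ} (hh : HessenbergOn n h) :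
    diagonalRows n h = [] ∧ 0 = 0 ∨ (diagonalRows n h).getLast? = some true := by
  cases n with
  | zero => left; simp [diagonalRows]
  | succ n =>
    right
    have h1 := hh.le_apply n (by omega)
    have h2 := hh.apply_lt n (by omega)
    simp only [diagonalRows, List.range_succ, List.map_append, List.map_cons, List.map_nil,
      List.getLast?_append, List.getLast?_singleton]
    simp
    omega

/-- The chromatic quasisymmetric function of a disjoint union of cliques, by splitting off the
first clique. -/
theorem chromaticSeries_idempotent (q : ℕ) : ∀ (N n : ℕ), n ≤ N → ∀ h : ℕ → ℕ,
    HessenbergOn n h → (∀ i < n, h (h i) = h i) →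
    chromaticSeries q n h = ((((blockLengths 0 (diagonalRows n h)).map fun a =>
      qFactorial q a • SymmFun.e ℤ a).prod : SymmFun ℤ) : MvPowerSeries ℕ ℤ) := by
  intro N
  induction N with
  | zero =>
    intro n hn h _ _
    obtain rfl : n = 0 := by omega
    rw [chromaticSeries_clique q 0 (by simp)]
    simp [qFactorial, SymmFun.e_zero, diagonalRows, blockLengths]
  | succ N ih =>
    intro n hn h hh hidem
    rcases Nat.eq_zero_or_pos n with rfl | hpos
    · exact ih 0 (by omega) h hh hidem
    have h0n := hh.apply_lt 0 hpos
    obtain ⟨b, hb⟩ := Nat.exists_eq_add_of_le (show h 0 + 1 ≤ n by omega)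
    set a := h 0 with ha
    have hblock : ∀ i < a + 1, h i = a := by
      intro i hi
      have h1 := hh.mono 0 i (by omega) (by omega)
      have h2 := hh.mono i a (by omega) (by omega)
      have h3 := hidem 0 hpos
      rw [← ha] at h1 h3
      omega
    subst hb
    have hge : ∀ i < b, i + (a + 1) ≤ h (i + (a + 1)) := fun i hi => hh.le_apply _ (by omega)
    have hlist : diagonalRows (a + 1 + b) h =
        List.replicate a false ++ true :: diagonalRows b fun i => h (i + (a + 1)) - (a + 1) := by
      have e1 : (List.range a).map (fun i => decide (h i = i)) = List.replicate a false := by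
        rw [List.eq_replicate_iff]
        refine ⟨by simp, fun c hc => ?_⟩
        obtain ⟨i, hi, rfl⟩ := List.mem_map.1 hc
        rw [List.mem_range] at hi
        rw [hblock i (by omega), decide_eq_false_iff_not]
        omega
      rw [diagonalRows, List.range_add, List.range_succ, List.map_append, List.map_append, e1,
        List.append_assoc]
      congr 1
      rw [List.map_cons, List.map_nil, hblock a (by omega), List.singleton_append]
      congr 1
      · simp
      · rw [List.map_map, diagonalRows]
        refine List.map_congr_left fun i hi => ?_
        rw [List.mem_range] at hi
        have := hge i hi
        simp only [Function.comp]
        refine decide_eq_decide.2 ?_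
        rw [add_comm (a + 1) i]
        omega
    rw [chromaticSeries_add q (fun i hi => by rw [hblock i hi]; omega)
      (fun i hi => by have := hge i hi; omega),
      chromaticSeries_clique q (a + 1) (fun i hi => by rw [hblock i hi]),
      ih b (by omega), hlist, blockLengths_replicate, blockLengths, List.map_cons, List.prod_cons,
      zero_add]
    · rfl
    · refine ⟨fun i hi => ?_, fun i hi => ?_, fun i j hij hj => ?_⟩
      · have := hge i hi
        omega
      · have := hh.apply_lt (i + (a + 1)) (by omega)
        omega
      · have := hh.mono (i + (a + 1)) (j + (a + 1)) (by omega) (by omega)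
        omega
    · intro i hi
      have h1 := hge i hi
      rw [Nat.sub_add_cancel (by omega), hidem _ (by omega)]

end Cliques

/-! ### The chromatic quasisymmetric functions are symmetric -/

section Symmetry

theorem ModularLaw.sub {n : ℕ} {q : ℤ} {f g : (ℕ → ℕ) → ℤ} (hf : ModularLaw n q f)
    (hg : ModularLaw n q g) : ModularLaw n q fun h => f h - g h where
  row h i a hi H0 H2 hrow := by
    linear_combination hf.row h i a hi H0 H2 hrow - hg.row h i a hi H0 H2 hrow
  col h i a hi H0 h1 h2 hne H2 := by
    linear_combination hf.col h i a hi H0 h1 h2 hne H2 - hg.col h i a hi H0 h1 h2 hne H2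

theorem degree_eq_of_mem_coloringsOfContent {n : ℕ} {d : ℕ →₀ ℕ} {κ : Fin n → ℕ}
    (hκ : κ ∈ coloringsOfContent n d) : d.degree = n := by
  rw [mem_coloringsOfContent] at hκ
  rw [← hκ, map_sum]
  simp

/-- The defect of symmetry has the modular law and vanishes for disjoint unions of cliques. -/
theorem chromaticSeries_mem {q : ℕ} (hq : 0 < q) {n : ℕ} {h : ℕ → ℕ} (hh : HessenbergOn n h) :
    chromaticSeries q n h ∈ SymmFun ℤ := by
  refine SymmFun.mem_of_coeff _ n (fun d hd => ?_) fun σ d => ?_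
  · rw [coeff_chromaticSeries]
    refine Finset.sum_eq_zero fun κ hκ => ?_
    rw [degree_eq_of_mem_coloringsOfContent hκ] at hd
    exact absurd hd (lt_irrefl n)
  · refine sub_eq_zero.1 <| ModularLaw.eq_zero_of_idempotent
      ((modularLaw_coeff_chromaticSeries q n (d.mapDomain σ)).sub
        (modularLaw_coeff_chromaticSeries q n d)) (by exact_mod_cast hq)
      (fun g hg hidem => ?_) hh
    rw [chromaticSeries_idempotent q n n le_rfl g hg hidem, SymmFun.coeff_mapDomain, sub_self]

theorem HessenbergOn.update_between {n : ℕ} {h : ℕ → ℕ} {i a : ℕ}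
    (H0 : HessenbergOn n (Function.update h i a))
    (H2 : HessenbergOn n (Function.update h i (a + 2))) :
    HessenbergOn n (Function.update h i (a + 1)) := by
  refine ⟨fun j hj => ?_, fun j hj => ?_, fun j k hjk hk => ?_⟩
  · have h0 := H0.le_apply j hj
    rw [Function.update_apply] at h0 ⊢
    split_ifs at h0 ⊢ <;> omega
  · have h2 := H2.apply_lt j hj
    rw [Function.update_apply] at h2 ⊢
    split_ifs at h2 ⊢ <;> omega
  · have h0 := H0.mono j k hjk hk
    have h2 := H2.mono j k hjk hk
    rw [Function.update_apply, Function.update_apply] at h0 h2 ⊢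
    split_ifs at h0 h2 ⊢ <;> omega

theorem HessenbergOn.update_succ {n : ℕ} {h : ℕ → ℕ} {i a : ℕ} (hi : i + 1 < n)
    (H0 : HessenbergOn n h) (h2 : h (i + 1) = a)
    (H2 : HessenbergOn n (Function.update (Function.update h (i + 1) (a + 1)) i (a + 1))) :
    HessenbergOn n (Function.update h (i + 1) (a + 1)) := by
  have hr : ∀ j, i + 1 < j → j < n → a + 1 ≤ h j := fun j hj hjn => by
    have := H2.mono (i + 1) j hj.le hjn
    rwa [Function.update_of_ne (by omega), Function.update_self,
      Function.update_of_ne (by omega), Function.update_of_ne (by omega)] at this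
  have ha := H2.apply_lt i (by omega)
  rw [Function.update_self] at ha
  refine ⟨fun j hj => ?_, fun j hj => ?_, fun j k hjk hk => ?_⟩
  · have h0 := H0.le_apply j hj
    rw [Function.update_apply]
    split_ifs with hji
    · subst hji; omega
    · exact h0
  · have h0 := H0.apply_lt j hj
    rw [Function.update_apply]
    split_ifs <;> omega
  · have h0 := H0.mono j k hjk hk
    rw [Function.update_apply, Function.update_apply]
    split_ifs with hji hki hki
    · exact le_rfl
    · exact hr k (by omega) hk
    · subst hki; omega
    · exact h0

open Classical in
/-- The modular law holds in the ring of symmetric functions, and is therefore kept by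
additive functionals on that ring. -/
theorem modularLaw_addMonoidHom {q : ℕ} (hq : 0 < q) (n : ℕ) (Φ : SymmFun ℤ →+ ℤ) :
    ModularLaw n q fun h => if hX : chromaticSeries q n h ∈ SymmFun ℤ then
      Φ ⟨chromaticSeries q n h, hX⟩ else 0 := by
  have key : ∀ h₀ h₁ h₂, HessenbergOn n h₀ → HessenbergOn n h₁ → HessenbergOn n h₂ →
      (∀ d, (1 + (q : ℤ)) * MvPowerSeries.coeff d (chromaticSeries q n h₁) =
        q * MvPowerSeries.coeff d (chromaticSeries q n h₀) +
          MvPowerSeries.coeff d (chromaticSeries q n h₂)) →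
      (1 + (q : ℤ)) * (if hX : chromaticSeries q n h₁ ∈ SymmFun ℤ then
        Φ ⟨chromaticSeries q n h₁, hX⟩ else 0) =
      q * (if hX : chromaticSeries q n h₀ ∈ SymmFun ℤ then
        Φ ⟨chromaticSeries q n h₀, hX⟩ else 0) +
      (if hX : chromaticSeries q n h₂ ∈ SymmFun ℤ then
        Φ ⟨chromaticSeries q n h₂, hX⟩ else 0) := by
    intro h₀ h₁ h₂ H0 H1 H2 hlaw
    rw [dif_pos (chromaticSeries_mem hq H0), dif_pos (chromaticSeries_mem hq H1),
      dif_pos (chromaticSeries_mem hq H2), ← smul_eq_mul, ← smul_eq_mul, ← map_zsmul, ← map_zsmul,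
      ← map_add]
    congr 1
    apply Subtype.ext
    ext d
    exact hlaw d
  refine ⟨fun h i a hi H0 H2 hrow => ?_, fun h i a hi H0 h1 h2 hne H2 => ?_⟩
  · exact key _ _ _ H0 (H0.update_between H2) H2 fun d =>
      (modularLaw_coeff_chromaticSeries q n d).row h i a hi H0 H2 hrow
  · exact key _ _ _ H0 (H0.update_succ hi h2 H2) H2 fun d =>
      (modularLaw_coeff_chromaticSeries q n d).col h i a hi H0 h1 h2 hne H2

end Symmetry

/-! ### Comparison on disjoint unions of cliques -/

section Idempotent

open Module

variable {F : Type*} [Field F] {n : ℕ}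

theorem list_prod_map_nsmul {R : Type*} [CommRing R] (c : ℕ → ℕ) (g : ℕ → R) (l : List ℕ) :
    (l.map fun a => c a • g a).prod = (l.map c).prod • (l.map g).prod := by
  induction l with
  | nil => simp
  | cons a l ih =>
    rw [List.map_cons, List.prod_cons, ih, List.map_cons, List.prod_cons, List.map_cons,
      List.prod_cons, smul_mul_smul_comm]

theorem ncard_invariantFlags [Finite F] (T : (Fin n → F) →ₗ[F] (Fin n → F)) (mu : n.Partition) :
    (invariantFlags T mu).ncard = chainCount T (mu.partsList.map fun a => (a, true)) ⊥ := by
  have h := ncard_chains T mu.partsList.length (fun i => (mu.partsList.get i, true)) ⊥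
  have e : List.ofFn (fun i => (mu.partsList.get i, true)) =
      mu.partsList.map fun a => (a, true) := by
    conv_rhs => rw [← List.ofFn_get mu.partsList, List.map_ofFn]
    rfl
  rw [e] at h
  rw [← h]
  congr 1
  ext W
  simp only [invariantFlags, Set.mem_ofPred_eq, mem_nextSteps]
  refine and_congr_right fun h0 => ⟨fun ⟨h1, h2, h3⟩ i => ⟨h1 i.castSucc_le_succ, h2 i,
    fun _ => h3 _⟩, fun h1 => ⟨Fin.monotone_iff_le_succ.2 fun i => (h1 i).1,
    fun i => (h1 i).2.1, fun i => ?_⟩⟩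
  refine Fin.cases ?_ (fun i => (h1 i).2.2 trivial) i
  rw [h0, Submodule.map_bot]

theorem hall_invariantFlagGF_hPart (T : (Fin n → F) →ₗ[F] (Fin n → F)) (nu : n.Partition) :
    SymmFun.hall ℤ (invariantFlagGF T) (SymmFun.hPart ℤ nu) = (invariantFlags T nu).ncard := by
  rw [invariantFlagGF, map_sum, LinearMap.sum_apply, Finset.sum_eq_single nu]
  · rw [map_nsmul, LinearMap.smul_apply, SymmFun.hall_m_hPart, if_pos rfl, nsmul_eq_mul, mul_one]
  · intro mu _ hmu
    rw [map_nsmul, LinearMap.smul_apply, SymmFun.hall_m_hPart,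
      if_neg fun h => hmu (Nat.Partition.ext h.symm), smul_zero]
  · simp

theorem apply_eq_apply_min {E : Type*} [AddCommGroup E] [Module F E] [FiniteDimensional F E]
    {V : ℕ → Submodule F E} (hV : Monotone V) (hfin : ∀ k, finrank F (V k) = min k n) (k : ℕ) :
    V k = V (min k n) :=
  (Submodule.eq_of_le_of_finrank_eq (hV (min_le_left k n)) (by rw [hfin, hfin]; omega)).symm

/-- For an idempotent `h` the conditions on a flag say that certain members are invariant. -/
theorem card_hessenbergFlags_idempotent [Finite F] (T : (Fin n → F) →ₗ[F] (Fin n → F))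
    {h : ℕ → ℕ} (hh : HessenbergOn n h) (hidem : ∀ i < n, h (h i) = h i) :
    (hessenbergFlags n T h).card =
      chainCount T ((diagonalRows n h).map fun b => (1, b)) ⊥ := by
  classical
  have e : (diagonalRows n h).map (fun b => (1, b)) =
      List.ofFn fun i : Fin n => (1, decide (h i = i)) := by
    rw [diagonalRows, List.map_map, List.ofFn_eq_map]
    rw [← List.map_coe_finRange_eq_range, List.map_map]
    rfl
  rw [e, ← ncard_chains, ← Set.ncard_coe_finset]
  refine Set.ncard_congr (fun V _ i => V i) ?_ ?_ ?_
  · intro V hV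
    rw [Finset.mem_coe, hessenbergFlags, Finset.mem_filter, mem_completeFlags] at hV
    obtain ⟨⟨hmono, hfin⟩, hT⟩ := hV
    simp only [Set.mem_ofPred_eq, mem_nextSteps]
    refine ⟨?_, fun i => ⟨hmono (by simp), ?_, fun hi => ?_⟩⟩
    · rw [← Submodule.finrank_eq_zero (R := F), Fin.val_zero, hfin, Nat.zero_min]
    · rw [hfin, hfin, Fin.val_succ, Fin.val_castSucc]
      omega
    · have := hT i i.2
      rw [of_decide_eq_true hi] at this
      exact this
  · intro V V' hV hV' hVV
    rw [Finset.mem_coe, hessenbergFlags, Finset.mem_filter, mem_completeFlags] at hV hV'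
    funext k
    rw [apply_eq_apply_min hV.1.1 hV.1.2, apply_eq_apply_min hV'.1.1 hV'.1.2]
    exact congrFun hVV ⟨min k n, by omega⟩
  · intro W hW
    simp only [Set.mem_ofPred_eq, mem_nextSteps] at hW
    have hmono : Monotone W := Fin.monotone_iff_le_succ.2 fun i => (hW.2 i).1
    have hfin : ∀ i : Fin (n + 1), finrank F (W i) = i := fun i => by
      induction i using Fin.induction with
      | zero => rw [hW.1, finrank_bot]; rfl
      | succ i ih => rw [(hW.2 i).2.1, ih]; simp
    have hVm : Monotone fun k => W ⟨min k n, by omega⟩ := fun j k hjk =>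
      hmono (Fin.mk_le_mk.2 (by omega))
    refine ⟨fun k => W ⟨min k n, by omega⟩, ?_, ?_⟩
    · rw [Finset.mem_coe, hessenbergFlags, Finset.mem_filter, mem_completeFlags]
      refine ⟨⟨hVm, fun k => hfin _⟩, fun i hi => ?_⟩
      have h1 := hh.apply_lt i hi
      have h2 := (hW.2 ⟨h i, h1⟩).2.2 (decide_eq_true (hidem i hi))
      have h3 : (⟨min (h i + 1) n, by omega⟩ : Fin (n + 1)) = Fin.succ ⟨h i, h1⟩ :=
        Fin.ext (min_eq_left h1)
      dsimp only
      rw [h3]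
      refine (Submodule.map_mono ?_).trans h2
      have h4 := hVm (Nat.succ_le_succ (hh.le_apply i hi))
      dsimp only at h4
      rw [← h3]
      exact h4
    · funext i
      exact congrArg W (Fin.ext (min_eq_left (by omega)))

/-- The theorem for disjoint unions of cliques. Both sides are the product of the `[a]!` over the
sizes `a` of the cliques, times a number of flags of invariant subspaces with jumps `a`; on
the right the jumps are in decreasing order, but that number does not depend on their order. -/
theorem card_hessenbergFlags_eq_hall [Finite F] (T : (Fin n → F) →ₗ[F] (Fin n → F))
    {h : ℕ → ℕ} (hh : HessenbergOn n h) (hidem : ∀ i < n, h (h i) = h i) :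
    ((hessenbergFlags n T h).card : ℤ) = SymmFun.hall ℤ (invariantFlagGF T)
      (SymmFun.omegaInv ℤ (((blockLengths 0 (diagonalRows n h)).map fun a =>
        qFactorial (Nat.card F) a • SymmFun.e ℤ a).prod)) := by
  set L := blockLengths 0 (diagonalRows n h) with hL
  let nu : n.Partition := ⟨(L : Multiset ℕ), fun {a} ha => blockLengths_pos _ _ a ha, by
    rw [Multiset.sum_coe, hL, sum_blockLengths _ _ hh.diagonalRows_getLast]
    simp [diagonalRows]⟩
  have hpart : (L.map (SymmFun.h ℤ)).prod = SymmFun.hPart ℤ nu := by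
    rw [SymmFun.hPart]
    change _ = (((L : Multiset ℕ)).map (SymmFun.h ℤ)).prod
    rw [Multiset.map_coe, Multiset.prod_coe]
  have hperm : nu.partsList.Perm L := Multiset.coe_eq_coe.1 (Multiset.sort_eq nu.parts (· ≥ ·))
  have hmap : (fun a => SymmFun.omegaInv ℤ (SymmFun.e ℤ a)) = SymmFun.h ℤ :=
    funext (SymmFun.omegaInv_e ℤ)
  rw [list_prod_map_nsmul, map_nsmul, map_list_prod, List.map_map]
  rw [show SymmFun.omegaInv ℤ ∘ SymmFun.e ℤ = SymmFun.h ℤ from hmap, hpart, map_nsmul,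
    hall_invariantFlagGF_hPart, ncard_invariantFlags, chainCount_perm T hperm ⊥ (by simp),
    card_hessenbergFlags_idempotent T hh hidem, nsmul_eq_mul, ← Nat.cast_mul]
  have := chainCount_blockLengths T _ 0 hh.diagonalRows_getLast ⊥
  rw [List.replicate_zero, List.nil_append] at this
  rw [this]

end Idempotent

/-! ### From functions on `Fin n` to functions on `ℕ` -/

section Extension

open Module

/-- The extension of a function `m` on `Fin n` to `ℕ` by the identity. -/
def extendToNat {n : ℕ} (m : Fin n → Fin n) (i : ℕ) : ℕ := if hi : i < n then m ⟨i, hi⟩ else i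

theorem extendToNat_val {n : ℕ} (m : Fin n → Fin n) (i : Fin n) : extendToNat m i = m i :=
  dif_pos i.2

theorem IsHessenberg.hessenbergOn {n : ℕ} {m : Fin n → Fin n} (hm : IsHessenberg m) :
    HessenbergOn n (extendToNat m) where
  le_apply i hi := by
    rw [extendToNat_val m ⟨i, hi⟩]
    exact hm.le_apply ⟨i, hi⟩
  apply_lt i hi := by
    rw [extendToNat_val m ⟨i, hi⟩]
    exact (m ⟨i, hi⟩).2
  mono i j hij hj := by
    rw [extendToNat_val m ⟨i, by omega⟩, extendToNat_val m ⟨j, hj⟩]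
    exact hm.monotone (Fin.mk_le_mk.2 hij)

theorem indifferenceGraph_adj_of_lt {n : ℕ} {m : Fin n → Fin n} {i j : Fin n} (hij : i < j) :
    (indifferenceGraph m).Adj i j ↔ (j : ℕ) ≤ extendToNat m i := by
  rw [indifferenceGraph, SimpleGraph.fromRel_adj, extendToNat_val, ← Fin.le_def]
  exact ⟨fun h => h.2.elim And.right fun h' => absurd h'.1 hij.not_gt,
    fun h => ⟨hij.ne, Or.inl ⟨hij, h⟩⟩⟩

theorem coloringWeight_coloring {n : ℕ} {m : Fin n → Fin n} (t : ℤ)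
    (κ : (indifferenceGraph m).Coloring ℕ) :
    coloringWeight t n (extendToNat m) κ = t ^ κ.asc := by
  classical
  have hset : {p : Fin n × Fin n | (indifferenceGraph m).Adj p.1 p.2 ∧ p.1 < p.2 ∧
      κ p.1 < κ p.2} = ((Finset.univ.filter fun p : Fin n × Fin n =>
        (indifferenceGraph m).Adj p.1 p.2 ∧ p.1 < p.2 ∧ κ p.1 < κ p.2 :
          Finset (Fin n × Fin n)) : Set (Fin n × Fin n)) := by
    ext p
    simp
  rw [SimpleGraph.Coloring.asc, hset, Set.ncard_coe_finset, coloringWeight,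
    ← Fintype.prod_prod_type' (f := fun i j : Fin n =>
      if i < j ∧ (j : ℕ) ≤ extendToNat m i then edgeWeight t (κ i) (κ j) else 1),
    ← Finset.prod_const, Finset.prod_filter]
  refine Finset.prod_congr rfl fun p _ => ?_
  by_cases hp : p.1 < p.2
  · by_cases ha : (indifferenceGraph m).Adj p.1 p.2
    · rw [if_pos ⟨hp, (indifferenceGraph_adj_of_lt hp).1 ha⟩, edgeWeight, if_neg (κ.valid ha)]
      exact if_congr ⟨fun h => ⟨ha, hp, h⟩, fun h => h.2.2⟩ rfl rfl
    · rw [if_neg fun h => ha ((indifferenceGraph_adj_of_lt hp).2 h.2), if_neg fun h => ha h.1]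
  · rw [if_neg fun h => hp h.1, if_neg fun h => hp h.2.1]

theorem coloringWeight_eq_zero {n : ℕ} {h : ℕ → ℕ} (t : ℤ) {κ : Fin n → ℕ} {i j : Fin n}
    (hij : i < j) (hj : (j : ℕ) ≤ h i) (hκ : κ i = κ j) : coloringWeight t n h κ = 0 := by
  refine Finset.prod_eq_zero (Finset.mem_univ i) (Finset.prod_eq_zero (Finset.mem_univ j) ?_)
  rw [if_pos ⟨hij, hj⟩, edgeWeight, if_pos hκ]

theorem chromaticQuasisymmetric_indifferenceGraph {n : ℕ} (m : Fin n → Fin n) (t : ℤ) :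
    (indifferenceGraph m).chromaticQuasisymmetric t = chromaticSeries t n (extendToNat m) := by
  funext d
  change ∑ᶠ κ ∈ {κ : (indifferenceGraph m).Coloring ℕ | κ.content = d}, t ^ κ.asc =
    ∑ κ ∈ coloringsOfContent n d, coloringWeight t n (extendToNat m) κ
  rw [finsum_mem_eq_finite_toFinset_sum _ (SimpleGraph.Coloring.finite_content_eq d)]
  refine Finset.sum_of_injOn (fun κ => (κ : Fin n → ℕ)) (fun κ _ κ' _ h => DFunLike.coe_injective h)
    ?_ ?_ fun κ _ => (coloringWeight_coloring t κ).symm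
  · intro κ hκ
    rw [Finset.mem_coe, Set.Finite.mem_toFinset] at hκ
    rw [Finset.mem_coe, mem_coloringsOfContent]
    exact hκ
  · intro κ hκ hne
    by_contra h0
    have hlt : ∀ i j : Fin n, i < j → (indifferenceGraph m).Adj i j → κ i ≠ κ j :=
      fun i j hij ha hc => h0 (coloringWeight_eq_zero t hij
        ((indifferenceGraph_adj_of_lt hij).1 ha) hc)
    refine hne ⟨SimpleGraph.Coloring.mk κ fun {i j} ha => ?_, ?_, rfl⟩
    · rcases lt_or_gt_of_ne ha.ne with hij | hij
      · exact hlt i j hij ha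
      · exact (hlt j i hij ha.symm).symm
    · rw [Finset.mem_coe, Set.Finite.mem_toFinset]
      exact mem_coloringsOfContent.1 hκ

theorem ncard_hessenbergVariety {F : Type*} [Field F] [Finite F] {n : ℕ} (m : Fin n → Fin n)
    (T : (Fin n → F) →ₗ[F] (Fin n → F)) :
    (hessenbergVariety m T).ncard = (hessenbergFlags n T (extendToNat m)).card := by
  classical
  rw [← Set.ncard_coe_finset]
  symm
  refine Set.ncard_congr (fun V _ i => V (i + 1)) ?_ ?_ ?_
  · intro V hV
    rw [Finset.mem_coe, hessenbergFlags, Finset.mem_filter, mem_completeFlags] at hV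
    obtain ⟨⟨hmono, hfin⟩, hT⟩ := hV
    refine ⟨fun i j hij => hmono (Nat.succ_le_succ hij), fun i => ?_, fun i => ?_⟩
    · rw [hfin]
      omega
    · have := hT i i.2
      rwa [extendToNat_val] at this
  · intro V V' hV hV' hVV
    rw [Finset.mem_coe, hessenbergFlags, Finset.mem_filter, mem_completeFlags] at hV hV'
    have hle : ∀ k ≤ n, V k = V' k := by
      intro k hk
      cases k with
      | zero =>
        have h0 : ∀ U : ℕ → Submodule F (Fin n → F), (∀ k, finrank F (U k) = min k n) →
            U 0 = ⊥ := fun U hU => by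
          rw [← Submodule.finrank_eq_zero (R := F), hU, Nat.zero_min]
        rw [h0 V hV.1.2, h0 V' hV'.1.2]
      | succ k => exact congrFun hVV ⟨k, hk⟩
    funext k
    rw [apply_eq_apply_min hV.1.1 hV.1.2, apply_eq_apply_min hV'.1.1 hV'.1.2,
      hle _ (min_le_right k n)]
  · rintro W ⟨hmono, hfin, hT⟩
    set V : ℕ → Submodule F (Fin n → F) := fun k =>
      if hk : min k n = 0 then ⊥ else W ⟨min k n - 1, by omega⟩ with hV
    have hVW : ∀ i : Fin n, V (i + 1) = W i := by
      intro i
      have h1 : min ((i : ℕ) + 1) n = i + 1 := min_eq_left i.2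
      rw [hV]
      dsimp only
      rw [dif_neg (by omega)]
      exact congrArg W (Fin.ext (by dsimp only; omega))
    refine ⟨V, ?_, funext hVW⟩
    rw [Finset.mem_coe, hessenbergFlags, Finset.mem_filter, mem_completeFlags]
    refine ⟨⟨fun j k hjk => ?_, fun k => ?_⟩, fun i hi => ?_⟩
    · rw [hV]
      dsimp only
      by_cases hj : min j n = 0
      · rw [dif_pos hj]
        exact bot_le
      · rw [dif_neg hj, dif_neg (by omega)]
        exact hmono (Fin.mk_le_mk.2 (by omega))
    · by_cases hk : min k n = 0
      · rw [show V k = ⊥ from dif_pos hk, finrank_bot, hk]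
      · rw [show V k = W ⟨min k n - 1, by omega⟩ from dif_neg hk, hfin]
        dsimp only
        omega
    · have := hT ⟨i, hi⟩
      rw [← hVW, ← hVW] at this
      rw [extendToNat_val m ⟨i, hi⟩]
      exact this

end Extension

theorem theorem1 {F : Type*} [Field F] [Fintype F] (n : ℕ) (T : (Fin n → F) →ₗ[F] (Fin n → F))
    (m : Fin n → Fin n) (hm : IsHessenberg m) :
    ∃ hX : (indifferenceGraph m).chromaticQuasisymmetric (Fintype.card F : ℤ) ∈ SymmFun ℤ,
      ((hessenbergVariety m T).ncard : ℤ) =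
        SymmFun.hall ℤ (invariantFlagGF T)
          (SymmFun.omegaInv ℤ
            ⟨(indifferenceGraph m).chromaticQuasisymmetric (Fintype.card F : ℤ), hX⟩) := by
  classical
  have hq : 0 < Nat.card F := Nat.card_pos
  have hX : chromaticSeries (Nat.card F) n (extendToNat m) ∈ SymmFun ℤ :=
    chromaticSeries_mem hq hm.hessenbergOn
  simp only [← Nat.card_eq_fintype_card, chromaticQuasisymmetric_indifferenceGraph,
    ncard_hessenbergVariety]
  refine ⟨hX, ?_⟩
  have h := ModularLaw.eq_zero_of_idempotent
    ((modularLaw_card_hessenbergFlags n T).sub (modularLaw_addMonoidHom hq n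
      ((SymmFun.hall ℤ (invariantFlagGF T)).toAddMonoidHom.comp
        (SymmFun.omegaInv ℤ : SymmFun ℤ →+ SymmFun ℤ))))
    (by exact_mod_cast hq) (fun g hg hidem => ?_) hm.hessenbergOn
  · rw [dif_pos hX] at h
    exact sub_eq_zero.1 h
  · have e : (⟨_, chromaticSeries_mem hq hg⟩ : SymmFun ℤ) = _ :=
      Subtype.ext (chromaticSeries_idempotent (Nat.card F) n n le_rfl g hg hidem)
    rw [dif_pos (chromaticSeries_mem hq hg), sub_eq_zero, card_hessenbergFlags_eq_hall T hg hidem,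
      AddMonoidHom.comp_apply, e]
    rfl
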